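/- **Setting.** Let $(\mathcal A,\tau)$ be a $C^*$-probability space ($\mathcal A$ a unital $C^*$-algebra, $\tau$ a faithful tracial state). A semicircular variable is a self-adjoint $s\in\mathcal A$ with $\tau(s^k)=\frac1{2\pi}\int_{-2}^{2}t^k\sqrt{4-t^2}\,dt$ for all $k\ge 0$; a free semicircular system is a free family of semicircular variables; a family is jointly semicircular if its members are real linear combinations of the members of some finite free semicircular system in $\mathcal A$. Let $n,d\geq 0$, let $A_1,\dots,A_n$ be monomials (with coefficient $1$) in noncommuting variables $X_1,\dots,X_d$, and let $x^1,\dots,x^n$ be $d$-tuples of semicircular variables in $\mathcal A$ such that the family $(x^i_u)_{i,u}$ is jointly semicircular and, for some real numbers $\kappa_{\{i,j\}}$, $$\tau(x^i_u x^j_v)=\delta_{u=v}\,\kappa_{\{i,j\}}\qquad (u,v\in[1,d],\ i,j\in[1,n],\ i=j \text{ included}).$$ **Fock space.** Let $\mathcal F=\bigoplus_{m\ge0}(\mathbb C^d)^{\otimes m}$ be the full Fock space over $\mathbb C^d$ with its standard basis $e_1,\dots,e_d$ and vacuum vector $\Omega$. Let $l_z$, $r_z$ be the left and right creation operators of $e_z$,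 let $x=(x_1,\dots,x_d)$ with $x_z=l_z+l_z^*$, let $P_m$ be the orthogonal projection onto $(\mathbb C^d)^{\otimes m}$, and put $\Delta_{\{i,j\}}=\sum_{m\ge1}\kappa_{\{i,j\}}^m P_m$. For an operator $T$ on $\mathcal F$ write $\tau(T)=\langle \Omega,T\Omega\rangle$ (inner product linear in the second argument). **Configurations.** Order $[1,n]$ cyclically; for $i\ne j$ let $[i,j]$ be the set of points met when going from $i$ to $j$ in increasing cyclic order, both ends included. A configuration is a set $K$ of unordered pairs of distinct elements of $[1,n]$ such that for all $\{i,j\},\{k,l\}\in K$ either $i,j\in[k,l]$ or $i,j\in[l,k]$ (an element may lie in several pairs or in none). Let $\mathcal K_n$ be the set of configurations and $\widehat K$ the set of elements of $[1,n]$ that lie in no pair of $K$. If the elements of $\{i\}\cup\{j:\{i,j\}\in K\}$, listed in increasing cyclic order from $i$, are $k_1=i,k_2,\dots,k_m$, let $C_i(K)$ be this set with the reversed cyclic order $(k_m,k_{m-1},\dots,k_2,k_1)$. For $j\in C_i(K)$ write $j^{-}$ and $j^+$ for its predecessor and successor in the cyclic order of $C_i(K)$ (so $i^+=k_m$ and $i^-=k_2$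 if $m\ge2$, and $i^+=i^-=i$ if $m=1$). Put $C_i^{**}(K)=C_i(K)\setminus\{i,i^-\}$. **Cut points.** For $K\in\mathcal K_n$, a system of cut points is a family of integers $k=(k_{i,j})_{i\in[1,n],\,j\in C_i^{**}(K)}$ such that for each $i$ with $C_i^{**}(K)\neq\emptyset$ $$0<k_{i,i^+}<k_{i,(i^+)^+}<\dots<k_{i,(i^-)^-}<\deg A_i .$$ It is completed by $k_{i,i}=0$ for all $i$ and $k_{i,i^-}=\deg A_i$ for $i\notin\widehat K$. For a monomial $A=X_{z_1}\cdots X_{z_m}$ write $A_{(u,v]}=X_{z_{u+1}}\cdots X_{z_v}$ and $A_{(u,v)}=X_{z_{u+1}}\cdots X_{z_{v-1}}$. For $\{i,j\}\in K$, labelled as $(i,j)$, let $T_{i,j}=T_{i,j}(K,k)$ be the following number, where all monomials are evaluated at $x$, $z_{k_{i,j}}$ denotes the index of the $k_{i,j}$-th letter of $A_i$, and $z_{k_{j,i}}$ that of the $k_{j,i}$-th letter of $A_j$. Here $j^-$ and $i^-$ in the subscripts of $k_{i,j^-}$ and $k_{j,i^-}$ are taken in $C_i(K)$ and in $C_j(K)$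 respectively. - If $j=i^-$ in $C_i(K)$ and $i=j^-$ in $C_j(K)$: $\ \tau\big((A_i)_{(k_{i,j^-},k_{i,j}]}\,\Delta_{\{i,j\}}\,(A_j)_{(k_{j,i^-},k_{j,i}]}\big)$. - If $j\ne i^-$ in $C_i(K)$ and $i=j^-$ in $C_j(K)$: $\ \tau\big((A_i)_{(k_{i,j^-},k_{i,j})}\,l^*_{z_{k_{i,j}}}\Delta_{\{i,j\}}\,(A_j)_{(k_{j,i^-},k_{j,i}]}\big)$. - If $j=i^-$ in $C_i(K)$ and $i\ne j^-$ in $C_j(K)$: $\ \tau\big((A_i)_{(k_{i,j^-},k_{i,j}]}\,\Delta_{\{i,j\}}\,r_{z_{k_{j,i}}}(A_j)_{(k_{j,i^-},k_{j,i})}\big)$. - If $j\ne i^-$ in $C_i(K)$ and $i\ne j^-$ in $C_j(K)$: $\ \tau\big((A_i)_{(k_{i,j^-},k_{i,j})}\,l^*_{z_{k_{i,j}}}\Delta_{\{i,j\}}\,r_{z_{k_{j,i}}}(A_j)_{(k_{j,i^-},k_{j,i})}\big)$. **Proposition.** The series $\Delta_{\{i,j\}}$ converge in the strong operator topology, and $$\tau\big(A_1(x^1)\cdots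 A_n(x^n)\big)=\sum_{K\in\mathcal K_n}\ \sum_{k}\ \prod_{i\in\widehat K}\tau(A_i(x))\prod_{\{i,j\}\in K}T_{i,j}(K,k),$$ where $k$ runs over the systems of cut points for $K$ and each unordered pair $\{i,j\}\in K$ contributes exactly one factor, the formula being valid for every choice of which end of the pair is labelled first. Moreover, for all monomials $B,C$ in $X_1,\dots,X_d$, all $a,b\in[1,d]$ and all $m\ge0$, $$\tau(B(x)P_mC(x))=\tau(C(x)P_mB(x)),$$ $$\tau(B(x)\,l_a^*P_m\,C(x))=\tau(C(x)\,P_m r_a\,B(x)),$$ $$\tau(B(x)\,P_m r_b\,C(x))=\tau(C(x)\,l_b^*P_m\,B(x)),$$ $$\tau(B(x)\,l_a^*P_m r_b\,C(x))=\tau(C(x)\,l_b^*P_m r_a\,B(x)).$$ -/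

import Mathlib

open scoped ComplexOrder

noncomputable section

namespace CircleConfig

/-! ### Noncommutative probability -/

/-- `(𝒜, τ)` is a `C*`-probability space: `τ` is a faithful tracial state on the unital
`C*`-algebra `𝒜`. -/
structure IsCStarProbabilitySpace {𝒜 : Type*} [CStarAlgebra 𝒜] (τ : 𝒜 →ₗ[ℂ] ℂ) : Prop where
  map_one : τ 1 = 1
  nonneg : ∀ a : 𝒜, 0 ≤ τ (star a * a)
  tracial : ∀ a b : 𝒜, τ (a * b) = τ (b * a)
  faithful : ∀ a : 𝒜, τ (star a * a) = 0 ↔ a = 0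

/-- Freeness of a family of `*`-subalgebras: an alternating product (of at least one factor)
of centred elements has trace zero. -/
def AreFree {𝒜 ι : Type*} [CStarAlgebra 𝒜] (τ : 𝒜 →ₗ[ℂ] ℂ)
    (S : ι → StarSubalgebra ℂ 𝒜) : Prop :=
  ∀ (k : ℕ) (j : Fin (k + 1) → ι) (a : Fin (k + 1) → 𝒜),
    (∀ t, a t ∈ S (j t)) →
    (∀ t : Fin k, j t.castSucc ≠ j t.succ) →
    τ (List.ofFn fun t => a t - algebraMap ℂ 𝒜 (τ (a t))).prod = 0

/-- A (standard) semicircular variable: self-adjoint, with the moments of the semicircle law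
`(2π)⁻¹ √(4 - t²) dt` on `[-2, 2]`. -/
def IsSemicircular {𝒜 : Type*} [CStarAlgebra 𝒜] (τ : 𝒜 →ₗ[ℂ] ℂ) (s : 𝒜) : Prop :=
  IsSelfAdjoint s ∧
    ∀ k : ℕ, τ (s ^ k) =
      ((∫ t in (-2 : ℝ)..2, t ^ k * (Real.sqrt (4 - t ^ 2) / (2 * Real.pi)) : ℝ) : ℂ)

/-- A free semicircular system: free semicircular variables. -/
def IsFreeSemicircularSystem {𝒜 ι : Type*} [CStarAlgebra 𝒜] (τ : 𝒜 →ₗ[ℂ] ℂ)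
    (s : ι → 𝒜) : Prop :=
  (∀ i, IsSemicircular τ (s i)) ∧ AreFree τ fun i => StarAlgebra.adjoin ℂ {s i}

/-- A jointly semicircular (not necessarily free) family: its members are real linear
combinations of the members of a free semicircular system. -/
def IsJointlySemicircular {𝒜 ι : Type*} [CStarAlgebra 𝒜] (τ : 𝒜 →ₗ[ℂ] ℂ)
    (y : ι → 𝒜) : Prop :=
  ∃ (m : ℕ) (s : Fin m → 𝒜), IsFreeSemicircularSystem τ s ∧
    ∀ i, y i ∈ Submodule.span ℝ (Set.range s)

/-- The monomial `X_{z₁} ⋯ X_{zₘ}`, encoded as the word `[z₁, …, zₘ]`, evaluated at `y`. -/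
def evalMonomial {B : Type*} [Monoid B] {d : ℕ} (w : List (Fin d)) (y : Fin d → B) : B :=
  (w.map y).prod

/-! ### The full Fock space over `ℂᵈ` -/

/-- The full Fock space `⨁ₙ (ℂᵈ)^{⊗ n}` (Hilbert direct sum), in the coordinates of its
orthonormal basis `e_{z₁} ⊗ ⋯ ⊗ e_{zₙ}`, which is indexed by the words `[z₁, …, zₙ]`. -/
abbrev FockSpace (d : ℕ) : Type := lp (fun _ : List (Fin d) => ℂ) 2

/-- The basis vector `e_{z₁} ⊗ ⋯ ⊗ e_{zₙ}`. -/
def ket {d : ℕ} (w : List (Fin d)) : FockSpace d :=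
  lp.single 2 w (1 : ℂ)

/-- The vacuum vector `Ω`. -/
def vacuum (d : ℕ) : FockSpace d := ket []

theorem norm_ket {d : ℕ} (w : List (Fin d)) : ‖ket w‖ = 1 := by
  unfold ket
  rw [lp.norm_single (by norm_num)]
  simp

theorem inner_ket {d : ℕ} (v w : List (Fin d)) :
    inner ℂ (ket v) (ket w) = if v = w then (1 : ℂ) else 0 := by
  unfold ket
  rw [lp.inner_single_left, lp.single_apply]
  by_cases h : v = w
  · subst h
    simp
  · simp [h]

theorem orthogonalFamily_ket {d : ℕ} {φ : List (Fin d) → List (Fin d)}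
    (hφ : Function.Injective φ) :
    OrthogonalFamily ℂ (fun _ : List (Fin d) => ℂ)
      (fun w => LinearIsometry.toSpanSingleton ℂ (FockSpace d) (norm_ket (φ w))) := by
  intro v w hvw a b
  simp [inner_smul_left, inner_smul_right, inner_ket, hφ.ne hvw]

/-- For an injective map `φ` of words, the isometry of the Fock space with
`ket w ↦ ket (φ w)`. -/
def wordShift {d : ℕ} {φ : List (Fin d) → List (Fin d)} (hφ : Function.Injective φ) :
    FockSpace d →L[ℂ] FockSpace d :=
  (orthogonalFamily_ket hφ).linearIsometry.toContinuousLinearMap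

theorem wordShift_ket {d : ℕ} {φ : List (Fin d) → List (Fin d)} (hφ : Function.Injective φ)
    (w : List (Fin d)) : wordShift hφ (ket w) = ket (φ w) := by
  have h := (orthogonalFamily_ket hφ).linearIsometry_apply_single (i := w) (1 : ℂ)
  simp only [LinearIsometry.toSpanSingleton_apply, one_smul] at h
  exact h

/-- The left creation operator `l_z`: `e_{z₁} ⊗ ⋯ ⊗ e_{zₙ} ↦ e_z ⊗ e_{z₁} ⊗ ⋯ ⊗ e_{zₙ}`. -/
def leftCreation {d : ℕ} (z : Fin d) : FockSpace d →L[ℂ] FockSpace d :=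
  wordShift (φ := fun w => z :: w) (List.cons_injective)

/-- The right creation operator `r_z`: `e_{z₁} ⊗ ⋯ ⊗ e_{zₙ} ↦ e_{z₁} ⊗ ⋯ ⊗ e_{zₙ} ⊗ e_z`. -/
def rightCreation {d : ℕ} (z : Fin d) : FockSpace d →L[ℂ] FockSpace d :=
  wordShift (φ := fun w => w ++ [z]) (List.append_left_injective [z])

/-- The left annihilation operator `l_z^*`. -/
def leftAnnihilation {d : ℕ} (z : Fin d) : FockSpace d →L[ℂ] FockSpace d :=
  ContinuousLinearMap.adjoint (leftCreation z)

/-- The free semicircular system `x_z = l_z + l_z^*` on the Fock space. -/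
def fockSemicircular {d : ℕ} (z : Fin d) : FockSpace d →L[ℂ] FockSpace d :=
  leftCreation z + leftAnnihilation z

/-- The subspace `(ℂᵈ)^{⊗ l}` of the Fock space. -/
def fockLevel (d l : ℕ) : Submodule ℂ (FockSpace d) :=
  (Submodule.span ℂ (ket '' {w : List (Fin d) | w.length = l})).topologicalClosure

instance (d l : ℕ) : CompleteSpace (fockLevel d l) :=
  (Submodule.isClosed_topologicalClosure _).completeSpace_coe

/-- The orthogonal projection `P_l` onto `(ℂᵈ)^{⊗ l}`. -/
def levelProj (d l : ℕ) : FockSpace d →L[ℂ] FockSpace d :=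
  (fockLevel d l).starProjection

/-- `Δ ξ = ∑_{l ≥ 1} c^l P_l ξ`. The series is to be understood in the strong operator topology;
its convergence for the relevant values of `c` is a matter to be proved. -/
def Delta {d : ℕ} (c : ℝ) (ξ : FockSpace d) : FockSpace d :=
  ∑' l : ℕ, (c : ℂ) ^ (l + 1) • levelProj d (l + 1) ξ

/-- The vacuum expectation `⟨Ω, T Ω⟩` (inner product linear in the second argument). -/
def vacuumState {d : ℕ} (T : FockSpace d → FockSpace d) : ℂ :=
  inner ℂ (vacuum d) (T (vacuum d))

/-! ### Configurations of the circle set with `n` elements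

The circle set is `Fin n` with its cyclic order; `(j - i).val` (subtraction modulo `n`) is the
number of counter-clockwise steps leading from `i` to `j`. -/

/-- The closed interval `[i, j]`: the points met on the way from `i` to `j`. -/
def arc {n : ℕ} (i j : Fin n) : Set (Fin n) :=
  {x | (x - i).val ≤ (j - i).val}

/-- A configuration: a set of pairs of distinct points which is noncrossing, where a point may
belong to several pairs or to none. -/
def IsConfiguration {n : ℕ} (K : Finset (Sym2 (Fin n))) : Prop :=
  (∀ e ∈ K, ¬ e.IsDiag) ∧
    ∀ i j k l : Fin n, s(i, j) ∈ K → s(k, l) ∈ K →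
      (i ∈ arc k l ∧ j ∈ arc k l) ∨ (i ∈ arc l k ∧ j ∈ arc l k)

open Classical in
/-- The set of configurations. -/
def configurations (n : ℕ) : Finset (Finset (Sym2 (Fin n))) :=
  Finset.univ.filter IsConfiguration

/-- `K̂`: the points that belong to no pair of `K`. -/
def isolated {n : ℕ} (K : Finset (Sym2 (Fin n))) : Finset (Fin n) :=
  Finset.univ.filter fun i => ∀ j, s(i, j) ∉ K

/-- `C_i(K)`: the point `i` and its neighbours. Listed counter-clockwise from `i` they are
`k₁ = i, k₂, …, kₘ`; the list `C_i(K)` is `kₘ, …, k₂, k₁`. -/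
def circ {n : ℕ} (K : Finset (Sym2 (Fin n))) (i : Fin n) : List (Fin n) :=
  (((List.finRange n).map fun t => i + t).filter fun j => j = i ∨ s(i, j) ∈ K).reverse

/-- `j⁻` with respect to the cyclic order of `C_i(K)` (and `j` if `j` is not in `C_i(K)`). -/
def circPred {n : ℕ} (K : Finset (Sym2 (Fin n))) (i j : Fin n) : Fin n :=
  if h : j ∈ circ K i then (circ K i).prev j h else j

/-- `C_i^{**}(K) = C_i(K) \ {i, i⁻}`. -/
def circStarStar {n : ℕ} (K : Finset (Sym2 (Fin n))) (i : Fin n) : List (Fin n) :=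
  (circ K i).filter fun j => j ≠ i ∧ j ≠ circPred K i i

/-- `k` is a system of cut points for the monomials `A` and the configuration `K`. The free
entries are those with `j ∈ C_i^{**}(K)`, and along `C_i^{**}(K) = {i⁺, …, (i⁻)⁻}` they satisfy
`0 < k_{i,i⁺} < ⋯ < k_{i,(i⁻)⁻} < deg A_i`; the other entries are fixed by `k_{i,i} = 0`,
`k_{i,i⁻} = deg A_i`, and, for the unused ones (`j ∉ C_i(K)`), by `k_{i,j} = 0`. -/
structure IsCutSystem {n d : ℕ} (A : Fin n → List (Fin d)) (K : Finset (Sym2 (Fin n)))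
    (k : Fin n → Fin n → ℕ) : Prop where
  self : ∀ i, k i i = 0
  last : ∀ i, i ∉ isolated K → k i (circPred K i i) = (A i).length
  chain : ∀ i, ∀ j ∈ circStarStar K i, k i (circPred K i j) < k i j ∧ k i j < (A i).length
  unused : ∀ i j, j ∉ circ K i → k i j = 0

open Classical in
/-- The finite set of systems of cut points. -/
def cutSystems {n d : ℕ} (A : Fin n → List (Fin d)) (K : Finset (Sym2 (Fin n))) :
    Finset (Fin n → Fin n → ℕ) :=
  (Fintype.piFinset fun i => Fintype.piFinset fun _ : Fin n =>
    Finset.range ((A i).length + 1)).filter (IsCutSystem A K)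

theorem mem_cutSystems {n d : ℕ} (A : Fin n → List (Fin d)) (K : Finset (Sym2 (Fin n)))
    (k : Fin n → Fin n → ℕ) : k ∈ cutSystems A K ↔ IsCutSystem A K k := by
  simp only [cutSystems, Finset.mem_filter, Fintype.mem_piFinset, Finset.mem_range,
    and_iff_right_iff_imp]
  intro h i j
  by_cases h1 : j ∈ circ K i
  · by_cases h2 : j = i
    · subst h2
      simp [h.self]
    · by_cases h3 : j = circPred K i i
      · have h4 : i ∉ isolated K := by
          have : s(i, j) ∈ K := by
            simp only [circ, List.mem_reverse, List.mem_filter, decide_eq_true_eq] at h1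
            exact h1.2.resolve_left h2
          simp only [isolated, Finset.mem_filter, not_and, not_forall, not_not]
          exact fun _ => ⟨j, this⟩
        rw [h3, h.last i h4]
        exact Nat.lt_succ_self _
      · have h5 : j ∈ circStarStar K i := by
          simp [circStarStar, h1, h2, h3]
        exact Nat.lt_succ_of_lt (h.chain i j h5).2
  · simp [h.unused i j h1]

/-! ### The pieces of the monomials and the pair traces -/

/-- `A_{(a,b]} = X_{z_{a+1}} ⋯ X_{z_b}` for `A = X_{z₁} ⋯ X_{zₘ}`. -/
def pieceIoc {d : ℕ} (A : List (Fin d)) (a b : ℕ) : List (Fin d) :=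
  (A.take b).drop a

/-- `A_{(a,b)} = X_{z_{a+1}} ⋯ X_{z_{b-1}}`. -/
def pieceIoo {d : ℕ} (A : List (Fin d)) (a b : ℕ) : List (Fin d) :=
  (A.take (b - 1)).drop a

/-- The operator `f z_b`, where `z_b` is the `b`-th letter of `A`, `1 ≤ b ≤ deg A`
(zero for other values of `b`, which do not occur). -/
def atLetter {d : ℕ} (f : Fin d → FockSpace d →L[ℂ] FockSpace d) (A : List (Fin d)) (b : ℕ) :
    FockSpace d →L[ℂ] FockSpace d :=
  if h : 1 ≤ b ∧ b ≤ A.length then f (A.get ⟨b - 1, by omega⟩) else 0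

/-- Evaluation of a monomial at the free semicircular system of the Fock space. -/
def evalFock {d : ℕ} (w : List (Fin d)) : FockSpace d →L[ℂ] FockSpace d :=
  evalMonomial w fockSemicircular

/-- The trace attached to the pair `{i, j}`, labelled as `(i, j)`. An operator `l^*` is inserted
to the left of `Δ` iff `j ≠ i⁻` in `C_i(K)`, and an operator `r` to its right iff `i ≠ j⁻` in
`C_j(K)`. -/
def pairTrace {n d : ℕ} (A : Fin n → List (Fin d)) (κ : Sym2 (Fin n) → ℝ)
    (K : Finset (Sym2 (Fin n))) (k : Fin n → Fin n → ℕ) (i j : Fin n) : ℂ :=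
  if j = circPred K i i then
    if i = circPred K j j then
      vacuumState fun ξ =>
        evalFock (pieceIoc (A i) (k i (circPred K i j)) (k i j))
          (Delta (κ s(i, j))
            (evalFock (pieceIoc (A j) (k j (circPred K j i)) (k j i)) ξ))
    else
      vacuumState fun ξ =>
        evalFock (pieceIoc (A i) (k i (circPred K i j)) (k i j))
          (Delta (κ s(i, j))
            (atLetter rightCreation (A j) (k j i)
              (evalFock (pieceIoo (A j) (k j (circPred K j i)) (k j i)) ξ)))
  else
    if i = circPred K j j then
      vacuumState fun ξ =>
        evalFock (pieceIoo (A i) (k i (circPred K i j)) (k i j))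
          (atLetter leftAnnihilation (A i) (k i j)
            (Delta (κ s(i, j))
              (evalFock (pieceIoc (A j) (k j (circPred K j i)) (k j i)) ξ)))
    else
      vacuumState fun ξ =>
        evalFock (pieceIoo (A i) (k i (circPred K i j)) (k i j))
          (atLetter leftAnnihilation (A i) (k i j)
            (Delta (κ s(i, j))
              (atLetter rightCreation (A j) (k j i)
                (evalFock (pieceIoo (A j) (k j (circPred K j i)) (k j i)) ξ))))

end CircleConfig

end

open CircleConfig

/-!
The family is given in terms of a free semicircular system `s`. In the algebra generated by `s`,
the Wick polynomial of a word is an alternating product of Chebyshev polynomials in single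
variables, which are centred for the semicircle law; by freeness it has trace zero unless the word
is empty. Hence the joint moments of `s` are the Wick coefficients, that is, the vacuum
expectations on the Fock space (`map_prod_eq_wickCoeff`). These satisfy the Schwinger–Dyson
equation, in which the first letter is paired with some other letter and cuts the word in two. Both
sides of the equation are multilinear, so that it passes to every jointly semicircular family
(`map_mul_prod_eq_dysonSum`).

For the mixed moment `τ (A₁(x¹) ⋯ Aₙ(xⁿ))` the pairings inside each word are summed separately:
the number of ways in which they can leave the word `w` unpaired is the Wick coefficient
`wickCoeff A w = ⟨e_w, A(x) Ω⟩`. The unpaired letters are linked to other words, and they are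
recorded by a labelling `ω`, where `ω a b` is the word of those letters of the `a`-th word that are
linked to the `b`-th one; so `ω b a` is the reverse of `ω a b`, and the pairs with `ω a b ≠ []` do
not cross. Let `linkSum` be the sum over all labellings of the weight `∏ κ_{ab}^{|ω_{ab}|}` times
the Wick coefficients of the words of linked letters. If the first letter of the first nonempty
word `i` is linked, then it is linked to the last neighbour `j` of `i`, and deleting this link
leaves an arbitrary labelling on `[i, j]` and another one on the points from `j` on
(`Joinable.isLabelling`, `IsLabelling.exists_join`). So `linkSum` satisfies the same
Schwinger–Dyson equation as the moment, and both are equal (`moment_eq_linkSum`).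

Finally the labellings are grouped by their support, which is a configuration `K`. The linked
letters of the `i`-th word form nonempty words for its neighbours, one after the other, and since a
linked letter is never enclosed by an inner pair, the Wick coefficient of the concatenation is a
sum over the positions of the last letters linked to the successive neighbours, the cut points
(`sum_cutRows`). For fixed `K` and cut points the remaining sum factors over the pairs in `K`, and
each factor is a vacuum expectation expanded in the basis `e_w` (`pairTrace_eq`). The symmetry
identities come from reversing `w` in such an expansion.
-/

namespace CircleConfig

/-! ### Words, splittings and Wick coefficients -/

section Words

variable {α β : Type*}

/-- The sum of `g y * f a b` over all ways of writing a word as `a ++ y :: b`. -/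
def splitSum (g : α → ℂ) : List α → (List α → List α → ℂ) → ℂ
  | [], _ => 0
  | y :: A, f => g y * f [] A + splitSum g A fun a b => f (y :: a) b

theorem splitSum_congr {g g' : α → ℂ} {A : List α} {f f' : List α → List α → ℂ}
    (h : ∀ a y b, A = a ++ y :: b → g y * f a b = g' y * f' a b) :
    splitSum g A f = splitSum g' A f' := by
  induction A generalizing f f' with
  | nil => rfl
  | cons y A ih =>
    simp only [splitSum]
    rw [h [] y A rfl]
    congr 1
    exact ih fun a z b hA => h (y :: a) z b (by rw [hA]; rfl)

theorem splitSum_append (g : α → ℂ) (A B : List α) (f : List α → List α → ℂ) :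
    splitSum g (A ++ B) f =
      splitSum g A (fun a b => f a (b ++ B)) + splitSum g B fun a b => f (A ++ a) b := by
  induction A generalizing f with
  | nil => simp [splitSum]
  | cons y A ih => simp only [List.cons_append, splitSum, ih, add_assoc]

theorem splitSum_map (g : β → ℂ) (φ : α → β) (A : List α) (f : List β → List β → ℂ) :
    splitSum g (A.map φ) f = splitSum (g ∘ φ) A fun a b => f (a.map φ) (b.map φ) := by
  induction A generalizing f with
  | nil => rfl
  | cons y A ih => simp [splitSum, ih]

theorem splitSum_add (g : α → ℂ) (A : List α) (f f' : List α → List α → ℂ) :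
    splitSum g A (fun a b => f a b + f' a b) = splitSum g A f + splitSum g A f' := by
  induction A generalizing f f' with
  | nil => simp [splitSum]
  | cons y A ih => simp only [splitSum, ih]; ring

theorem splitSum_mul_left (g : α → ℂ) (A : List α) (r : ℂ) (f : List α → List α → ℂ) :
    splitSum g A (fun a b => r * f a b) = r * splitSum g A f := by
  induction A generalizing f with
  | nil => simp [splitSum]
  | cons y A ih => simp only [splitSum, ih]; ring

theorem splitSum_mul_weight (g : α → ℂ) (A : List α) (r : ℂ) (f : List α → List α → ℂ) :
    splitSum (fun y => r * g y) A f = r * splitSum g A f := by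
  rw [← splitSum_mul_left]
  exact splitSum_congr fun a y b _ => by ring

theorem splitSum_add_weight (g g' : α → ℂ) (A : List α) (f : List α → List α → ℂ) :
    splitSum (fun y => g y + g' y) A f = splitSum g A f + splitSum g' A f := by
  induction A generalizing f with
  | nil => simp [splitSum]
  | cons y A ih => simp only [splitSum, ih]; ring

theorem splitSum_finsetSum {γ : Type*} (s : Finset γ) (g : α → ℂ) (A : List α)
    (f : γ → List α → List α → ℂ) :
    splitSum g A (fun a b => ∑ t ∈ s, f t a b) = ∑ t ∈ s, splitSum g A (f t) := by
  induction A generalizing f with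
  | nil => simp [splitSum]
  | cons y A ih => simp only [splitSum, ih, Finset.mul_sum, Finset.sum_add_distrib]

theorem splitSum_eq_sum_range (g : α → ℂ) (A : List α) (f : List α → List α → ℂ) :
    splitSum g A f =
      ∑ p ∈ Finset.range A.length, (A[p]?.elim 0 g) * f (A.take p) (A.drop (p + 1)) := by
  induction A generalizing f with
  | nil => simp [splitSum]
  | cons y A ih =>
    rw [splitSum, List.length_cons, Finset.sum_range_succ', ih, add_comm]
    simp

/-- The sum over the positions of a concatenation of `n` words, arranged by the word in which
the position lies. -/
theorem splitSum_flatten_ofFn (g : α → ℂ) {n : ℕ} (y : Fin n → List α)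
    (f : List α → List α → ℂ) :
    splitSum g (List.ofFn y).flatten f =
      ∑ j, splitSum g (y j) fun a b =>
        f (List.ofFn fun i => if i < j then y i else if i = j then a else []).flatten
          (List.ofFn fun i => if j < i then y i else if i = j then b else []).flatten := by
  induction n generalizing f with
  | zero => simp [splitSum]
  | succ n ih =>
    rw [List.ofFn_succ, List.flatten_cons, splitSum_append, Fin.sum_univ_succ, ih]
    congr 1
    · refine splitSum_congr fun a z b _ => ?_
      simp [List.ofFn_succ, Fin.succ_ne_zero, Fin.succ_pos]
    · refine Finset.sum_congr rfl fun j _ => splitSum_congr fun a z b _ => ?_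
      simp [List.ofFn_succ, Fin.succ_pos, (Fin.succ_ne_zero _).symm]

variable [DecidableEq α]

/-- The indicator function of the letter `z`. -/
def letterIndicator (z : α) : α → ℂ := fun y => if y = z then 1 else 0

/-- `stripHead z f w` is `f w'` if `w = z :: w'`, and zero for other words `w`. -/
def stripHead (z : α) (f : List α → ℂ) : List α → ℂ
  | [] => 0
  | y :: w => if y = z then f w else 0

/-- `stripLast z f w` is `f w'` if `w = w' ++ [z]`, and zero for other words `w`. -/
def stripLast (z : α) (f : List α → ℂ) (w : List α) : ℂ :=
  stripHead z (fun v => f v.reverse) w.reverse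

@[simp] theorem stripHead_nil (z : α) (f : List α → ℂ) : stripHead z f [] = 0 := rfl

@[simp] theorem stripHead_cons (z y : α) (f : List α → ℂ) (w : List α) :
    stripHead z f (y :: w) = if y = z then f w else 0 := rfl

@[simp] theorem stripLast_nil (z : α) (f : List α → ℂ) : stripLast z f [] = 0 := rfl

@[simp] theorem stripLast_concat (z y : α) (f : List α → ℂ) (w : List α) :
    stripLast z f (w ++ [y]) = if y = z then f w else 0 := by
  simp [stripLast]

/-- The coefficient of `e_w` in `A(x) Ω`, where `x` is the free semicircular system of the Fock
space: the number of ways of pairing some letters of `A` (equal letters, without crossings and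
without enclosing an unpaired letter) such that the unpaired letters spell `w`. -/
def wickCoeff : List α → List α → ℂ
  | [], w => if w = [] then 1 else 0
  | z :: A, w => wickCoeff A (z :: w) + stripHead z (wickCoeff A) w

theorem wickCoeff_nil (w : List α) : wickCoeff [] w = if w = [] then 1 else 0 := rfl

theorem wickCoeff_cons (z : α) (A w : List α) :
    wickCoeff (z :: A) w = wickCoeff A (z :: w) + stripHead z (wickCoeff A) w := rfl

theorem wickCoeff_concat (A : List α) (z : α) (w : List α) :
    wickCoeff (A ++ [z]) w = wickCoeff A (w ++ [z]) + stripLast z (wickCoeff A) w := by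
  induction A generalizing w with
  | nil =>
    rcases List.eq_nil_or_concat w with rfl | ⟨w', y, rfl⟩
    · simp [wickCoeff]
    · rw [List.concat_eq_append, List.nil_append, wickCoeff_cons, stripLast_concat]
      rcases w' with _ | ⟨a, w'⟩ <;> simp [wickCoeff]
  | cons y A ih =>
    rw [List.cons_append, wickCoeff_cons, ih, wickCoeff_cons]
    rcases w with _ | ⟨a, w⟩
    · have := stripLast_concat z y (wickCoeff A) []
      simp only [List.nil_append] at this
      simp [this, eq_comm]
    · simp only [List.cons_append, stripHead_cons, ih]
      rcases List.eq_nil_or_concat w with rfl | ⟨w', b, rfl⟩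
      · have h1 := stripLast_concat z a (wickCoeff A) [y]
        have h2 := stripLast_concat z a (wickCoeff (y :: A)) []
        simp only [List.nil_append, List.cons_append] at h1 h2
        simp only [List.nil_append, h1, h2, stripLast_nil, wickCoeff_cons,
          stripHead_nil]
        split_ifs <;> ring
      · have h1 := stripLast_concat z b (wickCoeff A) (y :: a :: w')
        have h2 := stripLast_concat z b (wickCoeff (y :: A)) (a :: w')
        simp only [List.concat_eq_append, List.cons_append] at h1 h2 ⊢
        simp only [h1, h2, stripLast_concat, wickCoeff_cons, stripHead_cons]
        split_ifs <;> ring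

theorem length_le_of_wickCoeff_ne_zero {A w : List α} (h : wickCoeff A w ≠ 0) :
    w.length ≤ A.length := by
  induction A generalizing w with
  | nil =>
    simp only [wickCoeff_nil, ne_eq, ite_eq_right_iff, one_ne_zero, imp_false, not_not] at h
    simp [h]
  | cons z A ih =>
    by_contra hlt
    simp only [List.length_cons, not_le] at hlt
    apply h
    rw [wickCoeff_cons]
    have h1 : wickCoeff A (z :: w) = 0 := by
      by_contra h1
      have := ih h1
      simp only [List.length_cons] at this
      omega
    rcases w with _ | ⟨y, w⟩
    · simp [h1]
    · have h2 : wickCoeff A w = 0 := by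
        by_contra h2
        have := ih h2
        simp only [List.length_cons] at hlt
        omega
      simp [h1, h2]

/-- The right-to-left recursion determines the Wick coefficients; it is satisfied by
`⟨Ω, A(x) e_w⟩` and by the trace of `A(s)` times the Wick polynomial of `w`. -/
theorem eq_wickCoeff_reverse {h : List α → List α → ℂ}
    (h0 : ∀ w, h [] w = if w = [] then 1 else 0)
    (hs : ∀ A z w, h (A ++ [z]) w = h A (z :: w) + stripHead z (h A) w) (A w : List α) :
    h A w = wickCoeff A w.reverse := by
  induction A using List.reverseRecOn generalizing w with
  | nil => rw [h0, wickCoeff_nil]; simp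
  | append_singleton A z ih =>
    rw [hs, wickCoeff_concat, ih, List.reverse_cons]
    congr 1
    rcases w with _ | ⟨y, w⟩
    · rfl
    · rw [List.reverse_cons, stripLast_concat, stripHead_cons, ih]

/-- A letter that stays unpaired cuts a word into two independent parts. -/
theorem wickCoeff_append_cons (A u : List α) (z : α) (v : List α) :
    wickCoeff A (u ++ z :: v) =
      splitSum (letterIndicator z) A fun a b => wickCoeff a u * wickCoeff b v := by
  induction A generalizing u with
  | nil => simp [wickCoeff, splitSum]
  | cons y A ih =>
    rw [wickCoeff_cons, splitSum]
    have h1 := ih (y :: u)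
    rw [List.cons_append] at h1
    rw [h1]
    rcases u with _ | ⟨a, u⟩
    · simp [wickCoeff, letterIndicator, eq_comm, add_comm]
    · rw [List.cons_append, stripHead_cons]
      simp only [wickCoeff_nil, reduceCtorEq, if_false, zero_mul, mul_zero, zero_add,
        wickCoeff_cons, stripHead_cons, add_mul, splitSum_add]
      congr 1
      split_ifs
      · rw [ih]
      · symm
        have := splitSum_mul_left (letterIndicator z) A 0 (fun _ _ => 0)
        simpa using this

/-- The first letter is unpaired, or paired with an equal letter. -/
theorem wickCoeff_cons_eq_splitSum (z : α) (A w : List α) :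
    wickCoeff (z :: A) w = stripHead z (wickCoeff A) w +
      splitSum (letterIndicator z) A fun a b => wickCoeff a [] * wickCoeff b w := by
  rw [wickCoeff_cons, add_comm, ← wickCoeff_append_cons, List.nil_append]

end Words

/-! ### Chebyshev polynomials and the semicircle law -/

section Semicircle

theorem integral_cos_nat_mul {n : ℕ} (hn : n ≠ 0) :
    ∫ θ in (0 : ℝ)..Real.pi, Real.cos (n * θ) = 0 := by
  have hn' : (n : ℝ) ≠ 0 := by exact_mod_cast hn
  rw [intervalIntegral.integral_comp_mul_left (fun u => Real.cos u) hn', integral_cos]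
  simp [Real.sin_nat_mul_pi]

/-- The rescaled Chebyshev polynomials of the second kind are orthogonal to the constants with
respect to the semicircle law. -/
theorem integral_chebyshevS_semicircle {n : ℕ} (hn : n ≠ 0) :
    ∫ t in (-2 : ℝ)..2, (Polynomial.Chebyshev.S ℝ n).eval t *
      (Real.sqrt (4 - t ^ 2) / (2 * Real.pi)) = 0 := by
  have hsub := intervalIntegral.integral_comp_mul_deriv (a := Real.pi) (b := 0)
    (f := fun θ => 2 * Real.cos θ) (f' := fun θ => 2 * -Real.sin θ)
    (g := fun t => (Polynomial.Chebyshev.S ℝ n).eval t *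
      (Real.sqrt (4 - t ^ 2) / (2 * Real.pi)))
    (fun θ _ => (Real.hasDerivAt_cos θ).const_mul 2) (by fun_prop)
    ((Polynomial.continuous _).mul (by fun_prop))
  simp only [Real.cos_pi, Real.cos_zero, mul_neg, mul_one, intervalIntegral.integral_neg] at hsub
  rw [← hsub, intervalIntegral.integral_symm, neg_neg]
  have hcongr : Set.EqOn
      (fun θ => ((fun t => (Polynomial.Chebyshev.S ℝ n).eval t *
        (Real.sqrt (4 - t ^ 2) / (2 * Real.pi))) ∘ fun θ => 2 * Real.cos θ) θ *
          (2 * Real.sin θ))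
      (fun θ => (1 / Real.pi) * (Real.cos (n * θ) - Real.cos ((n + 2 : ℕ) * θ)))
      (Set.uIcc 0 Real.pi) := by
    intro θ hθ
    rw [Set.uIcc_of_le Real.pi_pos.le] at hθ
    have hs : 0 ≤ Real.sin θ := Real.sin_nonneg_of_mem_Icc hθ
    have hsqrt : Real.sqrt (4 - (2 * Real.cos θ) ^ 2) = 2 * Real.sin θ := by
      rw [show 4 - (2 * Real.cos θ) ^ 2 = (2 * Real.sin θ) ^ 2 by
        nlinarith [Real.sin_sq_add_cos_sq θ], Real.sqrt_sq (by linarith)]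
    have hS : (Polynomial.Chebyshev.S ℝ n).eval (2 * Real.cos θ) * Real.sin θ =
        Real.sin ((n + 1) * θ) := by
      exact_mod_cast Polynomial.Chebyshev.S_two_mul_real_cos θ n
    have hprod : Real.cos (n * θ) - Real.cos ((n + 2 : ℕ) * θ) =
        2 * (Real.sin ((n + 1) * θ) * Real.sin θ) := by
      have e1 : (n : ℝ) * θ = (n + 1) * θ - θ := by ring
      have e2 : ((n + 2 : ℕ) : ℝ) * θ = (n + 1) * θ + θ := by push_cast; ring
      rw [e1, e2, Real.cos_sub, Real.cos_add]
      ring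
    simp only [Function.comp]
    rw [hsqrt, hprod, ← hS]
    have := Real.pi_ne_zero
    field_simp
  rw [intervalIntegral.integral_congr hcongr, intervalIntegral.integral_const_mul,
    intervalIntegral.integral_sub
      (Continuous.intervalIntegrable (by fun_prop) _ _)
      (Continuous.intervalIntegrable (by fun_prop) _ _),
    integral_cos_nat_mul hn, integral_cos_nat_mul (by omega)]
  simp

end Semicircle

/-! ### Wick polynomials of a free semicircular system -/

section Wick

variable {𝒜 : Type*} [CStarAlgebra 𝒜] {τ : 𝒜 →ₗ[ℂ] ℂ}

theorem IsSemicircular.map_aeval {s : 𝒜} (hs : IsSemicircular τ s) (p : Polynomial ℝ) :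
    τ (Polynomial.aeval s p) =
      ((∫ t in (-2 : ℝ)..2, p.eval t * (Real.sqrt (4 - t ^ 2) / (2 * Real.pi)) : ℝ) : ℂ) := by
  induction p using Polynomial.induction_on' with
  | add p q hp hq =>
    have hint (p : Polynomial ℝ) : IntervalIntegrable
        (fun t => p.eval t * (Real.sqrt (4 - t ^ 2) / (2 * Real.pi))) MeasureTheory.volume
        (-2) 2 :=
      (p.continuous.mul (by fun_prop)).intervalIntegrable _ _
    simp only [map_add, hp, hq, Polynomial.eval_add, add_mul]
    rw [intervalIntegral.integral_add (hint p) (hint q)]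
    push_cast
    rfl
  | monomial n a =>
    rw [Polynomial.aeval_monomial, Algebra.algebraMap_eq_smul_one, smul_mul_assoc, one_mul,
      ← Complex.coe_smul, map_smul, hs.2 n]
    simp only [Polynomial.eval_monomial, mul_assoc, intervalIntegral.integral_const_mul]
    simp

theorem IsSemicircular.map_aeval_chebyshevS {s : 𝒜} (hs : IsSemicircular τ s) {n : ℕ}
    (hn : n ≠ 0) : τ (Polynomial.aeval s (Polynomial.Chebyshev.S ℝ n)) = 0 := by
  rw [hs.map_aeval, integral_chebyshevS_semicircle hn, Complex.ofReal_zero]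

theorem IsSemicircular.map_sq (hτ : IsCStarProbabilitySpace τ) {s : 𝒜}
    (hs : IsSemicircular τ s) : τ (s * s) = 1 := by
  have h := hs.map_aeval_chebyshevS (n := 2) two_ne_zero
  rw [Nat.cast_ofNat, Polynomial.Chebyshev.S_two] at h
  simp only [map_sub, map_pow, Polynomial.aeval_X, map_one, hτ.map_one] at h
  rw [← pow_two]
  exact sub_eq_zero.mp h

variable {ι : Type*} [DecidableEq ι]

/-- The Wick polynomial of a word in the variables `s`; it takes `Ω` to `e_w` if `s` is the free
semicircular system of the Fock space. -/
noncomputable def wickPoly (s : ι → 𝒜) : List ι → 𝒜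
  | [] => 1
  | [z] => s z
  | z :: y :: w => s z * wickPoly s (y :: w) - if y = z then wickPoly s w else 0

theorem wickPoly_cons_of_head? (s : ι → 𝒜) (z : ι) (w : List ι) (h : w.head? ≠ some z) :
    wickPoly s (z :: w) = s z * wickPoly s w := by
  rcases w with _ | ⟨y, w⟩
  · simp [wickPoly]
  · have : y ≠ z := fun e => h (by simp [e])
    simp [wickPoly, this]

theorem map_mul_wickPoly (s : ι → 𝒜) (B : 𝒜) (z : ι) (w : List ι) :
    τ (B * s z * wickPoly s w) =
      τ (B * wickPoly s (z :: w)) + stripHead z (fun v => τ (B * wickPoly s v)) w := by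
  rcases w with _ | ⟨y, w⟩
  · simp [wickPoly]
  · rw [wickPoly, stripHead_cons, mul_sub, map_sub, mul_assoc]
    split_ifs <;> simp

/-- A run of equal letters contributes a Chebyshev polynomial. -/
theorem wickPoly_replicate_append (s : ι → 𝒜) (z : ι) (w : List ι) (h : w.head? ≠ some z)
    (n : ℕ) : wickPoly s (List.replicate n z ++ w) =
      Polynomial.aeval (s z) (Polynomial.Chebyshev.S ℝ n) * wickPoly s w := by
  induction n using Nat.twoStepInduction with
  | zero => simp
  | one => simp [wickPoly_cons_of_head? s z w h]
  | more n ih0 ih1 =>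
    rw [List.replicate_succ, List.replicate_succ, List.cons_append, List.cons_append, wickPoly,
      if_pos rfl, ih0, ← List.cons_append, ← List.replicate_succ, ih1]
    have := Polynomial.Chebyshev.S_add_two ℝ n
    push_cast at this ⊢
    rw [this]
    simp [sub_mul, mul_assoc]

/-- The Wick polynomial of a nonempty word is an alternating product of centred elements. -/
theorem exists_alternating_wickPoly {s : ι → 𝒜} (hs : ∀ i, IsSemicircular τ (s i)) (w : List ι)
    (hw : w ≠ []) : ∃ (k : ℕ) (j : Fin (k + 1) → ι) (a : Fin (k + 1) → 𝒜),
      w.head? = some (j 0) ∧ (∀ t, a t ∈ StarAlgebra.adjoin ℂ {s (j t)}) ∧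
      (∀ t, τ (a t) = 0) ∧ (∀ t : Fin k, j t.castSucc ≠ j t.succ) ∧
      (List.ofFn a).prod = wickPoly s w := by
  induction hl : w.length using Nat.strong_induction_on generalizing w with
  | _ N ih =>
  obtain ⟨z, w0, rfl⟩ := List.exists_cons_of_ne_nil hw
  obtain ⟨m, w', hw0, hhead⟩ : ∃ m w', z :: w0 = List.replicate (m + 1) z ++ w' ∧
      w'.head? ≠ some z := by
    clear ih hl hw
    induction w0 with
    | nil => exact ⟨0, [], by simp⟩
    | cons y w0 ih =>
      by_cases hy : y = z
      · subst hy
        obtain ⟨m, w', h1, h2⟩ := ih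
        exact ⟨m + 1, w', by rw [List.replicate_succ, List.cons_append, ← h1], h2⟩
      · exact ⟨0, y :: w0, by simp, by simpa using hy⟩
  have hmem : Polynomial.aeval (s z) (Polynomial.Chebyshev.S ℝ (m + 1 : ℕ)) ∈
      StarAlgebra.adjoin ℂ {s z} := by
    have h1 : s z ∈ (StarAlgebra.adjoin ℂ {s z}).toSubalgebra.restrictScalars ℝ :=
      StarAlgebra.self_mem_adjoin_singleton ℂ (s z)
    exact Algebra.adjoin_le (Set.singleton_subset_iff.mpr h1)
      (Polynomial.aeval_mem_adjoin_singleton ℝ (s z))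
  have htr := (hs z).map_aeval_chebyshevS (n := m + 1) (Nat.succ_ne_zero m)
  have hprod := wickPoly_replicate_append s z w' hhead (m + 1)
  rw [hw0]
  by_cases hw' : w' = []
  · subst hw'
    refine ⟨0, fun _ => z, fun _ => Polynomial.aeval (s z)
      (Polynomial.Chebyshev.S ℝ (m + 1 : ℕ)), by simp [List.replicate_succ], fun _ => hmem,
      fun _ => htr, fun t => t.elim0, ?_⟩
    rw [hprod]
    simp [wickPoly]
  · obtain ⟨k, j, a, h1, h2, h3, h4, h5⟩ := ih w'.length (by
      rw [← hl, hw0]; simp) w' hw' rfl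
    refine ⟨k + 1, Fin.cons z j, Fin.cons (Polynomial.aeval (s z)
      (Polynomial.Chebyshev.S ℝ (m + 1 : ℕ))) a, by simp [List.replicate_succ], ?_, ?_, ?_, ?_⟩
    · intro t
      refine Fin.cases ?_ (fun t => ?_) t
      · simpa using hmem
      · simpa using h2 t
    · intro t
      refine Fin.cases ?_ (fun t => ?_) t
      · simpa using htr
      · simpa using h3 t
    · intro t
      refine Fin.cases ?_ (fun t => ?_) t
      · intro h
        simp only [Fin.castSucc_zero, Fin.cons_zero, Fin.cons_succ] at h
        exact hhead (by rw [h1, h])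
      · rw [Fin.castSucc_succ, Fin.cons_succ, Fin.cons_succ]
        exact h4 t
    · rw [List.ofFn_succ, List.prod_cons, hprod, ← h5]
      simp

theorem map_wickPoly {s : ι → 𝒜} (hs : IsFreeSemicircularSystem τ s) {w : List ι}
    (hw : w ≠ []) : τ (wickPoly s w) = 0 := by
  obtain ⟨k, j, a, -, h2, h3, h4, h5⟩ := exists_alternating_wickPoly hs.1 w hw
  have := hs.2 k j a h2 h4
  simp only [h3, map_zero, sub_zero, h5] at this
  exact this

/-- The joint moments of a free semicircular system are those of the Fock space. -/
theorem map_prod_eq_wickCoeff (hτ : IsCStarProbabilitySpace τ) {s : ι → 𝒜}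
    (hs : IsFreeSemicircularSystem τ s) (A : List ι) :
    τ (A.map s).prod = wickCoeff A [] := by
  have h := eq_wickCoeff_reverse (h := fun A w => τ ((A.map s).prod * wickPoly s w)) ?_ ?_ A []
  · simpa [wickPoly] using h
  · intro w
    split_ifs with hw
    · simp [hw, wickPoly, hτ.map_one]
    · simpa using map_wickPoly hs hw
  · intro A z w
    simp only [List.map_append, List.map_cons, List.map_nil, List.prod_append, List.prod_cons,
      List.prod_nil, mul_one]
    exact map_mul_wickPoly s _ z w

end Wick

/-! ### The Schwinger–Dyson equation -/

section Dyson

variable {𝒜 : Type*} [CStarAlgebra 𝒜] {τ : 𝒜 →ₗ[ℂ] ℂ}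

/-- The right-hand side of the Schwinger–Dyson equation for `τ (y₀ * ys.prod)`. -/
noncomputable def dysonSum (τ : 𝒜 →ₗ[ℂ] ℂ) (y₀ : 𝒜) (ys : List 𝒜) : ℂ :=
  splitSum (fun y => τ (y₀ * y)) ys fun a b => τ a.prod * τ b.prod

theorem dysonSum_add_middle (y₀ y y' : 𝒜) (pre post : List 𝒜) :
    dysonSum τ y₀ (pre ++ (y + y') :: post) =
      dysonSum τ y₀ (pre ++ y :: post) + dysonSum τ y₀ (pre ++ y' :: post) := by
  simp only [dysonSum, splitSum_append, splitSum, List.prod_append, List.prod_cons, mul_add,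
    add_mul, map_add, splitSum_add, List.append_nil]
  ring

theorem dysonSum_smul_middle (y₀ : 𝒜) (c : ℂ) (y : 𝒜) (pre post : List 𝒜) :
    dysonSum τ y₀ (pre ++ (c • y) :: post) = c * dysonSum τ y₀ (pre ++ y :: post) := by
  simp only [dysonSum, splitSum_append, splitSum, List.prod_append, List.prod_cons, map_smul,
    smul_mul_assoc, mul_smul_comm, smul_eq_mul, List.append_nil, mul_add]
  rw [← splitSum_mul_left, ← splitSum_mul_left]
  congr 1
  · exact splitSum_congr fun _ _ _ _ => by ring
  · congr 1
    · ring
    · exact splitSum_congr fun _ _ _ _ => by ring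

theorem dysonSum_add_left (y₀ y₀' : 𝒜) (ys : List 𝒜) :
    dysonSum τ (y₀ + y₀') ys = dysonSum τ y₀ ys + dysonSum τ y₀' ys := by
  simp only [dysonSum, add_mul, map_add]
  exact splitSum_add_weight _ _ _ _

theorem dysonSum_smul_left (c : ℂ) (y₀ : 𝒜) (ys : List 𝒜) :
    dysonSum τ (c • y₀) ys = c * dysonSum τ y₀ ys := by
  simp only [dysonSum, smul_mul_assoc, map_smul, smul_eq_mul]
  exact splitSum_mul_weight _ _ _ _

theorem map_mul_prod_eq_dysonSum_of_free {ι : Type*} [DecidableEq ι]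
    (hτ : IsCStarProbabilitySpace τ) {s : ι → 𝒜} (hs : IsFreeSemicircularSystem τ s) (z : ι)
    (A : List ι) : τ (s z * (A.map s).prod) = dysonSum τ (s z) (A.map s) := by
  rw [← List.prod_cons, ← List.map_cons, map_prod_eq_wickCoeff hτ hs,
    wickCoeff_cons_eq_splitSum, stripHead_nil, zero_add, dysonSum, splitSum_map]
  refine splitSum_congr fun a y b _ => ?_
  have hcov := map_prod_eq_wickCoeff hτ hs [z, y]
  simp only [List.map_cons, List.map_nil, List.prod_cons, List.prod_nil, mul_one] at hcov
  simp only [Function.comp, hcov, map_prod_eq_wickCoeff hτ hs, letterIndicator]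
  rcases eq_or_ne y z with rfl | h
  · simp [wickCoeff_cons, wickCoeff_nil]
  · simp [wickCoeff_cons, wickCoeff_nil, h, h.symm]

/-- The Schwinger–Dyson equation for a jointly semicircular family; it follows from the one for
the free system because both sides are multilinear. -/
theorem map_mul_prod_eq_dysonSum {ι : Type*} [DecidableEq ι]
    (hτ : IsCStarProbabilitySpace τ) {s : ι → 𝒜} (hs : IsFreeSemicircularSystem τ s) (y₀ : 𝒜)
    (hy₀ : y₀ ∈ Submodule.span ℝ (Set.range s)) (ys : List 𝒜)
    (hys : ∀ y ∈ ys, y ∈ Submodule.span ℝ (Set.range s)) :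
    τ (y₀ * ys.prod) = dysonSum τ y₀ ys := by
  suffices H : ∀ post : List 𝒜, (∀ y ∈ post, y ∈ Submodule.span ℝ (Set.range s)) →
      ∀ pre : List ι, τ (y₀ * (pre.map s ++ post).prod) = dysonSum τ y₀ (pre.map s ++ post) by
    simpa using H ys hys []
  intro post
  induction post with
  | nil =>
    intro _ pre
    rw [List.append_nil]
    induction hy₀ using Submodule.span_induction with
    | mem y hy =>
      obtain ⟨i, rfl⟩ := hy
      exact map_mul_prod_eq_dysonSum_of_free hτ hs i pre
    | zero =>
      have := dysonSum_smul_left (τ := τ) 0 0 (pre.map s)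
      simp at this
      simp [this]
    | add x y _ _ hx hy => rw [add_mul, map_add, hx, hy, dysonSum_add_left]
    | smul a x _ hx =>
      rw [← Complex.coe_smul, dysonSum_smul_left, smul_mul_assoc, map_smul, hx, smul_eq_mul]
  | cons y post ih =>
    intro hpost pre
    have ih' := ih fun y' hy' => hpost y' (List.mem_cons_of_mem _ hy')
    have hy := hpost y List.mem_cons_self
    clear ih
    induction hy using Submodule.span_induction with
    | mem y hy =>
      obtain ⟨i, rfl⟩ := hy
      simpa using ih' (pre ++ [i])
    | zero =>
      have := dysonSum_smul_middle (τ := τ) y₀ 0 0 (pre.map s) post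
      simp only [zero_smul, zero_mul] at this
      simp [this]
    | add x y hx' hy' hx hy =>
      rw [dysonSum_add_middle, ← hx, ← hy]
      · simp [mul_add, add_mul]
      all_goals
        intro y'' hmem
        rcases List.mem_cons.mp hmem with rfl | hmem
        · assumption
        · exact hpost _ (List.mem_cons_of_mem _ hmem)
    | smul a x hx' hx =>
      rw [← Complex.coe_smul, dysonSum_smul_middle, ← hx]
      · simp
      · intro y'' hmem
        rcases List.mem_cons.mp hmem with rfl | hmem
        · assumption
        · exact hpost _ (List.mem_cons_of_mem _ hmem)

end Dyson

/-! ### Matrix coefficients on the Fock space -/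

section Fock

variable {d : ℕ}

/-- The finite set of words of length `m`. -/
def wordsOfLength (d m : ℕ) : Finset (List (Fin d)) :=
  (Finset.univ : Finset (Fin m → Fin d)).image List.ofFn

theorem mem_wordsOfLength {m : ℕ} {w : List (Fin d)} :
    w ∈ wordsOfLength d m ↔ w.length = m := by
  simp only [wordsOfLength, Finset.mem_image, Finset.mem_univ, true_and]
  constructor
  · rintro ⟨f, rfl⟩
    simp
  · rintro rfl
    exact ⟨w.get, List.ofFn_get w⟩

/-- The finite set of words of length at most `N`. -/
def wordsUpTo (d N : ℕ) : Finset (List (Fin d)) :=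
  (Finset.range (N + 1)).biUnion (wordsOfLength d)

theorem mem_wordsUpTo {N : ℕ} {w : List (Fin d)} : w ∈ wordsUpTo d N ↔ w.length ≤ N := by
  simp [wordsUpTo, mem_wordsOfLength]

theorem inner_ket_left (w : List (Fin d)) (ξ : FockSpace d) : inner ℂ (ket w) ξ = ξ w := by
  unfold ket
  rw [lp.inner_single_left]
  simp

theorem fock_ext {ξ η : FockSpace d} (h : ∀ w, inner ℂ (ket w) ξ = inner ℂ (ket w) η) :
    ξ = η := by
  ext w
  simpa [inner_ket_left] using h w

theorem leftCreation_ket (z : Fin d) (w : List (Fin d)) :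
    leftCreation z (ket w) = ket (z :: w) := wordShift_ket _ w

theorem rightCreation_ket (z : Fin d) (w : List (Fin d)) :
    rightCreation z (ket w) = ket (w ++ [z]) := wordShift_ket _ w

theorem leftAnnihilation_ket_nil (z : Fin d) : leftAnnihilation z (ket []) = 0 := by
  refine fock_ext fun v => ?_
  rw [leftAnnihilation, ContinuousLinearMap.adjoint_inner_right, leftCreation_ket, inner_ket,
    inner_zero_right, if_neg (List.cons_ne_nil z v)]

theorem leftAnnihilation_ket_cons (z y : Fin d) (w : List (Fin d)) :
    leftAnnihilation z (ket (y :: w)) = if y = z then ket w else 0 := by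
  refine fock_ext fun v => ?_
  rw [leftAnnihilation, ContinuousLinearMap.adjoint_inner_right, leftCreation_ket, inner_ket]
  by_cases h : y = z
  · simp [h, inner_ket]
  · simp [h, Ne.symm h]

theorem inner_leftAnnihilation (z : Fin d) (w : List (Fin d)) (ξ : FockSpace d) :
    inner ℂ (ket w) (leftAnnihilation z ξ) = inner ℂ (ket (z :: w)) ξ := by
  rw [leftAnnihilation, ContinuousLinearMap.adjoint_inner_right, leftCreation_ket]

theorem inner_leftCreation (z : Fin d) (w : List (Fin d)) (ξ : FockSpace d) :
    inner ℂ (ket w) (leftCreation z ξ) = stripHead z (fun v => inner ℂ (ket v) ξ) w := by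
  rw [← ContinuousLinearMap.adjoint_inner_left, ← leftAnnihilation]
  rcases w with _ | ⟨y, w⟩
  · simp [leftAnnihilation_ket_nil]
  · rw [leftAnnihilation_ket_cons, stripHead_cons]
    split_ifs <;> simp

theorem inner_rightCreation (z : Fin d) (w : List (Fin d)) (ξ : FockSpace d) :
    inner ℂ (ket w) (rightCreation z ξ) = stripLast z (fun v => inner ℂ (ket v) ξ) w := by
  rw [← ContinuousLinearMap.adjoint_inner_left]
  rcases List.eq_nil_or_concat w with rfl | ⟨w, y, rfl⟩
  · have : ContinuousLinearMap.adjoint (rightCreation z) (ket []) = 0 := by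
      refine fock_ext fun v => ?_
      rw [ContinuousLinearMap.adjoint_inner_right, rightCreation_ket, inner_ket,
        inner_zero_right, if_neg (by simp)]
    simp [this]
  · have : ContinuousLinearMap.adjoint (rightCreation z) (ket (w ++ [y])) =
        if y = z then ket w else 0 := by
      refine fock_ext fun v => ?_
      rw [ContinuousLinearMap.adjoint_inner_right, rightCreation_ket, inner_ket]
      by_cases h : y = z
      · simp [h, inner_ket]
      · simp [h, Ne.symm h]
    rw [List.concat_eq_append, this, stripLast_concat]
    split_ifs <;> simp

theorem evalFock_nil : evalFock ([] : List (Fin d)) = 1 := rfl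

theorem evalFock_cons (z : Fin d) (A : List (Fin d)) :
    evalFock (z :: A) = (leftCreation z + leftAnnihilation z) * evalFock A := by
  simp [evalFock, evalMonomial, fockSemicircular]

theorem evalFock_concat (z : Fin d) (A : List (Fin d)) :
    evalFock (A ++ [z]) = evalFock A * (leftCreation z + leftAnnihilation z) := by
  simp [evalFock, evalMonomial, fockSemicircular]

theorem inner_ket_evalFock_vacuum (A w : List (Fin d)) :
    inner ℂ (ket w) (evalFock A (vacuum d)) = wickCoeff A w := by
  induction A generalizing w with
  | nil => simp [evalFock_nil, vacuum, inner_ket, wickCoeff_nil]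
  | cons z A ih =>
    rw [evalFock_cons, mul_apply_eq_comp, add_apply,
      inner_add_right, inner_leftCreation, inner_leftAnnihilation, wickCoeff_cons, add_comm, ih]
    simp only [ih]

theorem inner_vacuum_evalFock_ket (A w : List (Fin d)) :
    inner ℂ (vacuum d) (evalFock A (ket w)) = wickCoeff A w.reverse := by
  refine eq_wickCoeff_reverse (h := fun A w => inner ℂ (vacuum d) (evalFock A (ket w)))
    ?_ ?_ A w
  · intro w
    simp [evalFock_nil, vacuum, inner_ket, eq_comm]
  · intro A z w
    simp only [evalFock_concat, mul_apply_eq_comp, add_apply,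
      map_add, inner_add_right, leftCreation_ket]
    rcases w with _ | ⟨y, w⟩
    · simp [leftAnnihilation_ket_nil]
    · rw [leftAnnihilation_ket_cons, stripHead_cons]
      split_ifs <;> simp

theorem vacuumState_evalFock (A : List (Fin d)) :
    vacuumState (evalFock A) = wickCoeff A [] :=
  inner_ket_evalFock_vacuum A []

theorem inner_vacuum_evalFock_leftAnnihilation_ket (A : List (Fin d)) (z : Fin d)
    (w : List (Fin d)) : inner ℂ (vacuum d) (evalFock A (leftAnnihilation z (ket w))) =
      stripLast z (wickCoeff A) w.reverse := by
  rw [stripLast, List.reverse_reverse]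
  rcases w with _ | ⟨y, w⟩
  · simp [leftAnnihilation_ket_nil]
  · rw [leftAnnihilation_ket_cons, stripHead_cons, ← inner_vacuum_evalFock_ket]
    split_ifs <;> simp

theorem inner_ket_rightCreation_evalFock (A : List (Fin d)) (z : Fin d) (w : List (Fin d)) :
    inner ℂ (ket w) (rightCreation z (evalFock A (vacuum d))) =
      stripLast z (wickCoeff A) w := by
  rw [inner_rightCreation]
  simp only [inner_ket_evalFock_vacuum]

/-- The projection onto a level, in coordinates. -/
theorem levelProj_apply (m : ℕ) (ξ : FockSpace d) :
    levelProj d m ξ = ∑ w ∈ wordsOfLength d m, (inner ℂ (ket w) ξ : ℂ) • ket w := by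
  refine Submodule.eq_starProjection_of_mem_of_inner_eq_zero ?_ ?_
  · refine Submodule.le_topologicalClosure _ (Submodule.sum_mem _ fun w hw => ?_)
    exact Submodule.smul_mem _ _
      (Submodule.subset_span ⟨w, mem_wordsOfLength.mp hw, rfl⟩)
  · set v := ξ - ∑ w ∈ wordsOfLength d m, (inner ℂ (ket w) ξ : ℂ) • ket w
    suffices h : fockLevel d m ≤ (innerSL ℂ v).ker from
      fun w hw => h hw
    refine Submodule.topologicalClosure_minimal _ (Submodule.span_le.mpr ?_)
      (ContinuousLinearMap.isClosed_ker _)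
    rintro _ ⟨w, hw, rfl⟩
    have hw' : w ∈ wordsOfLength d m := mem_wordsOfLength.mpr hw
    change inner ℂ v (ket w) = 0
    rw [← inner_conj_symm, map_eq_zero, inner_sub_right, inner_sum]
    simp [inner_smul_right, inner_ket, hw']

theorem inner_vacuum_levelProj (T : FockSpace d →L[ℂ] FockSpace d) (m : ℕ) (ξ : FockSpace d) :
    inner ℂ (vacuum d) (T (levelProj d m ξ)) =
      ∑ w ∈ wordsOfLength d m, inner ℂ (vacuum d) (T (ket w)) * inner ℂ (ket w) ξ := by
  rw [levelProj_apply, map_sum, inner_sum]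
  exact Finset.sum_congr rfl fun w _ => by rw [map_smul, inner_smul_right, mul_comm]

theorem sum_wordsOfLength_reverse (m : ℕ) (f g : List (Fin d) → ℂ) :
    ∑ w ∈ wordsOfLength d m, f w.reverse * g w =
      ∑ w ∈ wordsOfLength d m, g w.reverse * f w := by
  refine Finset.sum_nbij' List.reverse List.reverse ?_ ?_ ?_ ?_ ?_
  · intro w hw; simpa [mem_wordsOfLength] using hw
  · intro w hw; simpa [mem_wordsOfLength] using hw
  · intro w _; simp
  · intro w _; simp
  · intro w _; rw [List.reverse_reverse, mul_comm]

/-- The four symmetry identities: both sides are the same sum over words, read backwards. -/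
theorem vacuumState_levelProj_symm (B C : List (Fin d)) (a b : Fin d) (l : ℕ) :
    vacuumState (evalFock B * levelProj d l * evalFock C) =
        vacuumState (evalFock C * levelProj d l * evalFock B) ∧
      vacuumState (evalFock B * leftAnnihilation a * levelProj d l * evalFock C) =
        vacuumState (evalFock C * levelProj d l * rightCreation a * evalFock B) ∧
      vacuumState (evalFock B * levelProj d l * rightCreation b * evalFock C) =
        vacuumState (evalFock C * leftAnnihilation b * levelProj d l * evalFock B) ∧
      vacuumState
          (evalFock B * leftAnnihilation a * levelProj d l * rightCreation b * evalFock C) =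
        vacuumState
          (evalFock C * leftAnnihilation b * levelProj d l * rightCreation a * evalFock B) := by
  have h (A : List (Fin d)) (z : Fin d) (ξ : FockSpace d) :
      inner ℂ (vacuum d) (evalFock A (leftAnnihilation z (levelProj d l ξ))) =
        ∑ w ∈ wordsOfLength d l, stripLast z (wickCoeff A) w.reverse * inner ℂ (ket w) ξ := by
    rw [← mul_apply_eq_comp (evalFock A), inner_vacuum_levelProj]
    simp only [mul_apply_eq_comp, inner_vacuum_evalFock_leftAnnihilation_ket]
  refine ⟨?_, ?_, ?_, ?_⟩ <;>
    simp only [vacuumState, mul_apply_eq_comp, h, inner_vacuum_levelProj,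
      inner_vacuum_evalFock_ket, inner_ket_evalFock_vacuum, inner_ket_rightCreation_evalFock] <;>
    exact sum_wordsOfLength_reverse l _ _

/-- On vectors with finitely many levels the series `Δ` is a finite sum. -/
theorem inner_vacuum_Delta (T : FockSpace d →L[ℂ] FockSpace d) (c : ℝ) (N : ℕ)
    (ξ : FockSpace d) (hξ : ∀ w : List (Fin d), N < w.length → inner ℂ (ket w) ξ = 0) :
    inner ℂ (vacuum d) (T (Delta c ξ)) =
      ∑ w ∈ (wordsUpTo d N).filter (· ≠ []), (c : ℂ) ^ w.length *
        (inner ℂ (vacuum d) (T (ket w)) * inner ℂ (ket w) ξ) := by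
  have hz : ∀ l ∉ Finset.range N, (c : ℂ) ^ (l + 1) • levelProj d (l + 1) ξ = 0 := by
    intro l hl
    rw [levelProj_apply, Finset.sum_eq_zero, smul_zero]
    intro w hw
    rw [mem_wordsOfLength] at hw
    rw [hξ w (by simp at hl; omega), zero_smul]
  have hU : (wordsUpTo d N).filter (· ≠ []) =
      (Finset.range N).biUnion fun l => wordsOfLength d (l + 1) := by
    ext w
    rcases w with _ | ⟨y, w⟩ <;>
      simp [mem_wordsUpTo, mem_wordsOfLength]
  rw [Delta, tsum_eq_sum hz, map_sum, inner_sum, hU, Finset.sum_biUnion]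
  · refine Finset.sum_congr rfl fun l _ => ?_
    rw [map_smul, inner_smul_right, inner_vacuum_levelProj, Finset.mul_sum]
    refine Finset.sum_congr rfl fun w hw => ?_
    rw [mem_wordsOfLength.mp hw]
  · intro l _ m _ hlm
    refine Finset.disjoint_left.mpr fun w hw hw' => hlm ?_
    rw [mem_wordsOfLength] at hw hw'
    omega

theorem memℓp_pow_length_mul {c : ℝ} (hc : |c| ≤ 1) (ξ : FockSpace d) :
    Memℓp (fun w : List (Fin d) => (c : ℂ) ^ w.length * ξ w) 2 := by
  have h2 : 0 < (2 : ENNReal).toReal := by norm_num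
  have hξ := (memℓp_gen_iff h2).mp (lp.memℓp ξ)
  refine memℓp_gen (Summable.of_nonneg_of_le (fun w => by positivity) (fun w => ?_) hξ)
  refine Real.rpow_le_rpow (norm_nonneg _) ?_ h2.le
  rw [norm_mul, norm_pow, Complex.norm_real, Real.norm_eq_abs]
  exact mul_le_of_le_one_left (norm_nonneg _) (pow_le_one₀ (abs_nonneg c) hc)

theorem summable_smul_ket (η : FockSpace d) : Summable fun w => η w • ket w := by
  refine (lp.hasSum_single (by norm_num) η).summable.congr fun w => ?_
  unfold ket
  rw [← lp.single_smul, smul_eq_mul, mul_one]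

/-- Strong convergence of `Δ`; for `d = 0` every term vanishes. -/
theorem summable_levelProj (c : ℝ) (hc : d ≠ 0 → |c| ≤ 1) (ξ : FockSpace d) :
    Summable fun l : ℕ => (c : ℂ) ^ (l + 1) • levelProj d (l + 1) ξ := by
  rcases eq_or_ne d 0 with rfl | hd
  · convert summable_zero with l
    rw [levelProj_apply, Finset.sum_eq_zero, smul_zero]
    intro w hw
    rw [mem_wordsOfLength] at hw
    rcases w with _ | ⟨z, w⟩
    · simp at hw
    · exact z.elim0
  have h1 := summable_smul_ket (d := d) ⟨_, memℓp_pow_length_mul (hc hd) ξ⟩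
  have h2 := ((Equiv.sigmaFiberEquiv (List.length (α := Fin d))).summable_iff.mpr h1).sigma
  refine ((summable_nat_add_iff 1).mpr h2).congr fun l => ?_
  rw [levelProj_apply, Finset.smul_sum]
  have h3 := (Equiv.subtypeEquivRight fun w => mem_wordsOfLength (m := l + 1) (w := w)).tsum_eq
    fun v : {w : List (Fin d) // w.length = l + 1} =>
      ((c : ℂ) ^ v.1.length * ξ v.1) • ket v.1
  refine h3.symm.trans ?_
  refine (Finset.tsum_subtype (wordsOfLength d (l + 1)) fun w =>
    ((c : ℂ) ^ w.length * ξ w) • ket w).trans (Finset.sum_congr rfl fun w hw => ?_)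
  rw [mem_wordsOfLength.mp hw, inner_ket_left, mul_smul]

end Fock

/-! ### Noncrossing labellings -/

section Labellings

variable {n d : ℕ}

/-- The points with the property `p`, in decreasing order. -/
def descending (p : Fin n → Prop) [DecidablePred p] : List (Fin n) :=
  ((List.finRange n).filter fun b => p b).reverse

theorem mem_descending {p : Fin n → Prop} [DecidablePred p] {b : Fin n} :
    b ∈ descending p ↔ p b := by
  simp [descending]

theorem pairwise_descending (p : Fin n → Prop) [DecidablePred p] :
    (descending p).Pairwise (· > ·) := by
  rw [descending, List.pairwise_reverse]
  exact (List.pairwise_lt_finRange n).filter _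

theorem eq_descending {p : Fin n → Prop} [DecidablePred p] {l : List (Fin n)}
    (hl : l.Pairwise (· > ·)) (h : ∀ b, b ∈ l ↔ p b) : l = descending p :=
  hl.eq_of_mem_iff (pairwise_descending p) fun b => by rw [h, mem_descending]

/-- The other points, read in decreasing cyclic order starting before `i`. This is the order in
which the letters of the `i`-th word are linked to the other words. -/
def nbrOrder (i : Fin n) : List (Fin n) := descending (· < i) ++ descending (i < ·)

theorem mem_nbrOrder {i b : Fin n} : b ∈ nbrOrder i ↔ b ≠ i := by
  simp [nbrOrder, mem_descending]

theorem nbrOrder_eq_of_lt {i j : Fin n} (hij : i < j) :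
    nbrOrder i = (descending (· < i) ++ descending (j < ·)) ++
      j :: descending fun b => i < b ∧ b < j := by
  rw [nbrOrder, List.append_assoc, List.append_cancel_left_eq]
  refine (eq_descending ?_ ?_).symm
  · rw [List.pairwise_append, List.pairwise_cons]
    refine ⟨pairwise_descending _, ⟨?_, pairwise_descending _⟩, ?_⟩
    · intro b hb
      exact (mem_descending.mp hb).2
    · intro a ha b hb
      rw [mem_descending] at ha
      rcases List.mem_cons.mp hb with rfl | hb
      · exact ha
      · exact (mem_descending.mp hb).2.trans ha
  · intro b
    simp only [List.mem_append, List.mem_cons, mem_descending]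
    omega

theorem nbrOrder_eq_of_gt {i j : Fin n} (hij : i < j) :
    nbrOrder j = ((descending fun b => i < b ∧ b < j) ++
      i :: descending (· < i)) ++ descending (j < ·) := by
  rw [nbrOrder, List.append_cancel_right_eq]
  refine (eq_descending ?_ ?_).symm
  · rw [List.pairwise_append, List.pairwise_cons]
    refine ⟨pairwise_descending _, ⟨?_, pairwise_descending _⟩, ?_⟩
    · intro b hb
      exact mem_descending.mp hb
    · intro a ha b hb
      rw [mem_descending] at ha
      rcases List.mem_cons.mp hb with rfl | hb
      · exact ha.1
      · exact (mem_descending.mp hb).trans ha.1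
  · intro b
    simp only [List.mem_append, List.mem_cons, mem_descending]
    omega

/-- A noncrossing labelling: `ω a b` is the word spelled by the letters of the `a`-th word that
are linked to the `b`-th word, so that `ω b a` is its reverse. -/
structure IsLabelling (ω : Fin n → Fin n → List (Fin d)) : Prop where
  symm : ∀ a b, ω b a = (ω a b).reverse
  diag : ∀ a, ω a a = []
  noncrossing : ∀ a c b e, a < c → c < b → b < e → ω a b ≠ [] → ω c e = []

theorem IsLabelling.ne_nil_symm {ω : Fin n → Fin n → List (Fin d)} (h : IsLabelling ω)
    {a b : Fin n} (hab : ω a b ≠ []) : ω b a ≠ [] := by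
  rwa [h.symm, ne_eq, List.reverse_eq_nil_iff]

open Classical in
/-- The finite set of noncrossing labellings by words of length at most `N`. -/
noncomputable def labellings (n d N : ℕ) : Finset (Fin n → Fin n → List (Fin d)) :=
  (Fintype.piFinset fun _ => Fintype.piFinset fun _ => wordsUpTo d N).filter IsLabelling

theorem mem_labellings {N : ℕ} {ω : Fin n → Fin n → List (Fin d)} :
    ω ∈ labellings n d N ↔ (∀ a b, (ω a b).length ≤ N) ∧ IsLabelling ω := by
  simp [labellings, mem_wordsUpTo]

/-- The linked letters of the `i`-th word. -/
def blockWord (ω : Fin n → Fin n → List (Fin d)) (i : Fin n) : List (Fin d) :=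
  ((nbrOrder i).map (ω i)).flatten

theorem flatten_map_eq_nil {l : List (Fin n)} {f : Fin n → List (Fin d)}
    (h : ∀ b ∈ l, f b = []) : (l.map f).flatten = [] := by
  simpa [List.flatten_eq_nil_iff] using h

theorem flatten_map_congr {l : List (Fin n)} {f g : Fin n → List (Fin d)}
    (h : ∀ b ∈ l, f b = g b) : (l.map f).flatten = (l.map g).flatten := by
  rw [List.map_congr_left h]

theorem blockWord_congr {ω ω' : Fin n → Fin n → List (Fin d)} {i : Fin n}
    (h : ∀ b, b ≠ i → ω i b = ω' i b) : blockWord ω i = blockWord ω' i :=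
  flatten_map_congr fun b hb => h b (mem_nbrOrder.mp hb)

theorem blockWord_eq_nil_iff {ω : Fin n → Fin n → List (Fin d)} (hω : IsLabelling ω)
    {i : Fin n} : blockWord ω i = [] ↔ ∀ b, ω i b = [] := by
  refine ⟨fun h b => ?_, fun h => flatten_map_eq_nil fun b _ => h b⟩
  by_cases hb : b = i
  · rw [hb, hω.diag]
  · rw [blockWord, List.flatten_eq_nil_iff] at h
    exact h _ (List.mem_map_of_mem (mem_nbrOrder.mpr hb))

theorem length_le_blockWord {ω : Fin n → Fin n → List (Fin d)} (hω : IsLabelling ω)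
    (i b : Fin n) : (ω i b).length ≤ (blockWord ω i).length := by
  by_cases hb : b = i
  · rw [hb, hω.diag]
    exact Nat.zero_le _
  · have h : ω i b ∈ (nbrOrder i).map (ω i) := List.mem_map_of_mem (mem_nbrOrder.mpr hb)
    rw [blockWord, List.length_flatten]
    exact List.single_le_sum (fun _ _ => Nat.zero_le _) _ (List.mem_map_of_mem h)

/-- Two labellings that can be joined along a new link from `i` to `j`: the first one lives on
`[i, j]` and the second one on the points from `j` on. -/
structure Joinable (i j : Fin n) (ω₁ ω₂ : Fin n → Fin n → List (Fin d)) : Prop where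
  lt : i < j
  left : IsLabelling ω₁
  right : IsLabelling ω₂
  left_lo : ∀ a b, a < i → ω₁ a b = []
  left_hi : ∀ a b, j < a → ω₁ a b = []
  right_lo : ∀ a b, a < j → ω₂ a b = []

/-- The labelling with a new outermost link, labelled `z`, from `i` to `j`. -/
def joinLabelling (i j : Fin n) (z : Fin d) (ω₁ ω₂ : Fin n → Fin n → List (Fin d)) :
    Fin n → Fin n → List (Fin d) := fun a b =>
  if a = i ∧ b = j then z :: ω₁ i j
  else if a = j ∧ b = i then ω₁ j i ++ [z]
  else if a ≤ j ∧ b ≤ j then ω₁ a b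
  else ω₂ a b

namespace Joinable

variable {i j : Fin n} {z : Fin d} {ω₁ ω₂ : Fin n → Fin n → List (Fin d)}

theorem left_lo' (h : Joinable i j ω₁ ω₂) (a b : Fin n) (hb : b < i) : ω₁ a b = [] := by
  rw [h.left.symm b a, h.left_lo b a hb, List.reverse_nil]

theorem left_hi' (h : Joinable i j ω₁ ω₂) (a b : Fin n) (hb : j < b) : ω₁ a b = [] := by
  rw [h.left.symm b a, h.left_hi b a hb, List.reverse_nil]

theorem right_lo' (h : Joinable i j ω₁ ω₂) (a b : Fin n) (hb : b < j) : ω₂ a b = [] := by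
  rw [h.right.symm b a, h.right_lo b a hb, List.reverse_nil]

theorem join_first : joinLabelling i j z ω₁ ω₂ i j = z :: ω₁ i j := by simp [joinLabelling]

theorem join_last (h : Joinable i j ω₁ ω₂) :
    joinLabelling i j z ω₁ ω₂ j i = ω₁ j i ++ [z] := by
  simp [joinLabelling, h.lt.ne']

theorem join_left (a b : Fin n) (h1 : ¬ (a = i ∧ b = j)) (h2 : ¬ (a = j ∧ b = i))
    (ha : a ≤ j) (hb : b ≤ j) : joinLabelling i j z ω₁ ω₂ a b = ω₁ a b := by
  simp [joinLabelling, h1, h2, ha, hb]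

theorem join_right (h : Joinable i j ω₁ ω₂) (a b : Fin n) (hab : ¬ (a ≤ j ∧ b ≤ j)) :
    joinLabelling i j z ω₁ ω₂ a b = ω₂ a b := by
  rw [joinLabelling, if_neg (by rintro ⟨rfl, rfl⟩; exact hab ⟨h.lt.le, le_rfl⟩),
    if_neg (by rintro ⟨rfl, rfl⟩; exact hab ⟨le_rfl, h.lt.le⟩), if_neg hab]

theorem isLabelling (h : Joinable i j ω₁ ω₂) : IsLabelling (joinLabelling i j z ω₁ ω₂) where
  symm a b := by
    by_cases h1 : a = i ∧ b = j
    · obtain ⟨rfl, rfl⟩ := h1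
      rw [join_first, h.join_last, h.left.symm a b, List.reverse_cons]
    by_cases h2 : a = j ∧ b = i
    · obtain ⟨rfl, rfl⟩ := h2
      rw [join_first, h.join_last, h.left.symm a b]
      simp
    by_cases h3 : a ≤ j ∧ b ≤ j
    · rw [join_left a b h1 h2 h3.1 h3.2, join_left b a (fun e => h2 ⟨e.2, e.1⟩)
        (fun e => h1 ⟨e.2, e.1⟩) h3.2 h3.1, h.left.symm a b]
    · rw [h.join_right a b h3, h.join_right b a fun e => h3 ⟨e.2, e.1⟩, h.right.symm a b]
  diag a := by
    have hij := h.lt.ne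
    by_cases ha : a ≤ j
    · rw [join_left a a (fun e => hij (e.1.symm.trans e.2))
        (fun e => hij (e.2.symm.trans e.1)) ha ha, h.left.diag]
    · rw [h.join_right a a fun e => ha e.1, h.right.diag]
  noncrossing a c b e hac hcb hbe hab := by
    have hij := h.lt
    by_cases he : e ≤ j
    · rw [join_left a b (by omega) (by omega) (by omega) (by omega)] at hab
      by_cases hce : c = i ∧ e = j
      · exact absurd (h.left_lo a b (by omega)) hab
      · rw [join_left c e hce (by omega) (by omega) he]
        exact h.left.noncrossing a c b e hac hcb hbe hab
    · rw [h.join_right c e (by omega)]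
      by_contra hce
      have hc : ¬ c < j := fun hc => hce (h.right_lo c e hc)
      rw [h.join_right a b (by omega)] at hab
      exact hce (h.right.noncrossing a c b e hac hcb hbe hab)

theorem join_eq_left_of_lt (h : Joinable i j ω₁ ω₂) {a : Fin n} (hai : a ≠ i) (haj : a < j)
    (b : Fin n) : joinLabelling i j z ω₁ ω₂ a b = ω₁ a b := by
  by_cases hb : b ≤ j
  · exact join_left a b (fun e => hai e.1) (fun e => haj.ne e.1) haj.le hb
  · rw [h.join_right a b fun e => hb e.2, h.right_lo a b haj, h.left_hi' a b (not_le.mp hb)]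

theorem join_eq_right_of_gt (h : Joinable i j ω₁ ω₂) {a : Fin n} (haj : j < a)
    (b : Fin n) : joinLabelling i j z ω₁ ω₂ a b = ω₂ a b :=
  h.join_right a b fun e => haj.not_ge e.1

theorem blockWord_join_left (h : Joinable i j ω₁ ω₂) {a : Fin n} (hai : a ≠ i) (haj : a < j) :
    blockWord (joinLabelling i j z ω₁ ω₂) a = blockWord ω₁ a :=
  blockWord_congr fun b _ => h.join_eq_left_of_lt hai haj b

theorem blockWord_join_right (h : Joinable i j ω₁ ω₂) {a : Fin n} (haj : j < a) :
    blockWord (joinLabelling i j z ω₁ ω₂) a = blockWord ω₂ a :=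
  blockWord_congr fun b _ => h.join_eq_right_of_gt haj b

theorem blockWord_join_first (h : Joinable i j ω₁ ω₂) :
    blockWord (joinLabelling i j z ω₁ ω₂) i = z :: blockWord ω₁ i := by
  have hij := h.lt
  have h0 (ω : Fin n → Fin n → List (Fin d)) (hω : ∀ b, b < i ∨ j < b → ω i b = []) :
      blockWord ω i = ω i j ++ ((descending fun b => i < b ∧ b < j).map (ω i)).flatten := by
    rw [blockWord, nbrOrder_eq_of_lt hij, List.map_append, List.flatten_append,
      flatten_map_eq_nil, List.nil_append, List.map_cons, List.flatten_cons]
    intro b hb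
    rw [List.mem_append, mem_descending, mem_descending] at hb
    exact hω b hb
  rw [h0, h0 ω₁, join_first, List.cons_append, flatten_map_congr]
  · intro b hb
    rw [mem_descending] at hb
    exact join_left i b (by omega) (by omega) hij.le hb.2.le
  · rintro b (hb | hb)
    · exact h.left_lo' i b hb
    · exact h.left_hi' i b hb
  · rintro b (hb | hb)
    · rw [join_left i b (by omega) (by omega) hij.le (by omega), h.left_lo' i b hb]
    · rw [h.join_right i b (by omega), h.right_lo i b hij]

theorem blockWord_join_last (h : Joinable i j ω₁ ω₂) :
    blockWord (joinLabelling i j z ω₁ ω₂) j = blockWord ω₁ j ++ z :: blockWord ω₂ j := by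
  have hij := h.lt
  have h1 : blockWord ω₁ j =
      ((descending fun b => i < b ∧ b < j).map (ω₁ j)).flatten ++ ω₁ j i := by
    rw [blockWord, nbrOrder_eq_of_gt hij]
    simp only [List.map_append, List.flatten_append, List.map_cons, List.flatten_cons]
    rw [flatten_map_eq_nil (l := descending (· < i)), flatten_map_eq_nil (l := descending (j < ·)),
      List.append_nil, List.append_nil]
    · exact fun b hb => h.left_hi' j b (mem_descending.mp hb)
    · exact fun b hb => h.left_lo' j b ((mem_descending (p := (· < i))).mp hb)
  have h2 : blockWord ω₂ j = ((descending (j < ·)).map (ω₂ j)).flatten := by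
    rw [blockWord, nbrOrder, List.map_append, List.flatten_append, flatten_map_eq_nil,
      List.nil_append]
    exact fun b hb => h.right_lo' j b ((mem_descending (p := (· < j))).mp hb)
  have h3 : ((descending fun b => i < b ∧ b < j).map (joinLabelling i j z ω₁ ω₂ j)).flatten =
      ((descending fun b => i < b ∧ b < j).map (ω₁ j)).flatten :=
    flatten_map_congr fun b hb => by
      rw [mem_descending] at hb
      exact join_left j b (by omega) (by omega) le_rfl hb.2.le
  have h4 : ((descending (j < ·)).map (joinLabelling i j z ω₁ ω₂ j)).flatten =
      ((descending (j < ·)).map (ω₂ j)).flatten :=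
    flatten_map_congr fun b hb => by
      rw [mem_descending] at hb
      exact h.join_right j b (by omega)
  rw [blockWord, nbrOrder_eq_of_gt hij]
  simp only [List.map_append, List.flatten_append, List.map_cons, List.flatten_cons]
  rw [h3, h4, h1, h2, h.join_last, flatten_map_eq_nil (l := descending (· < i))]
  · simp
  · intro b hb
    rw [mem_descending] at hb
    rw [join_left j b (by omega) (by omega) le_rfl (by omega), h.left_lo' j b hb]

/-- The last neighbour of `i`, and then both parts, can be read off the joined labelling. -/
theorem join_injective {j' : Fin n} {ω₁' ω₂' : Fin n → Fin n → List (Fin d)}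
    (h : Joinable i j ω₁ ω₂) (h' : Joinable i j' ω₁' ω₂')
    (e : joinLabelling i j z ω₁ ω₂ = joinLabelling i j' z ω₁' ω₂') :
    j = j' ∧ ω₁ = ω₁' ∧ ω₂ = ω₂' := by
  have key {j j' : Fin n} {ω₁ ω₂ ω₁' ω₂' : Fin n → Fin n → List (Fin d)}
      (h : Joinable i j ω₁ ω₂) (h' : Joinable i j' ω₁' ω₂')
      (e : joinLabelling i j z ω₁ ω₂ = joinLabelling i j' z ω₁' ω₂') : j' ≤ j := by
    by_contra hlt
    have h1 := congr_fun (congr_fun e i) j'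
    rw [join_first, h.join_right i j' (fun e => hlt e.2), h.right_lo i j' h.lt] at h1
    exact List.cons_ne_nil _ _ h1.symm
  obtain rfl : j = j' := le_antisymm (key h' h e.symm) (key h h' e)
  refine ⟨rfl, ?_, ?_⟩
  · funext a b
    have hab := congr_fun (congr_fun e a) b
    by_cases h1 : a = i ∧ b = j
    · obtain ⟨rfl, rfl⟩ := h1
      rw [join_first, join_first] at hab
      exact (List.cons.inj hab).2
    by_cases h2 : a = j ∧ b = i
    · obtain ⟨rfl, rfl⟩ := h2
      rw [h.join_last, h'.join_last] at hab
      exact List.append_cancel_right hab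
    by_cases h3 : a ≤ j ∧ b ≤ j
    · rwa [join_left a b h1 h2 h3.1 h3.2, join_left a b h1 h2 h3.1 h3.2] at hab
    · by_cases ha : a ≤ j
      · rw [h.left_hi' a b (by omega), h'.left_hi' a b (by omega)]
      · rw [h.left_hi a b (by omega), h'.left_hi a b (by omega)]
  · funext a b
    have hab := congr_fun (congr_fun e a) b
    by_cases h3 : a ≤ j ∧ b ≤ j
    · by_cases ha : a = j
      · by_cases hb : b = j
        · rw [ha, hb, h.right.diag, h'.right.diag]
        · rw [h.right_lo' a b (by omega), h'.right_lo' a b (by omega)]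
      · rw [h.right_lo a b (by omega), h'.right_lo a b (by omega)]
    · rwa [h.join_right a b h3, h'.join_right a b h3] at hab

end Joinable

/-- A labelling whose first nonempty point is `i` arises by joining two labellings along the first
link of `i`, which leads to the last neighbour of `i`. -/
theorem IsLabelling.exists_join {ω : Fin n → Fin n → List (Fin d)} (hω : IsLabelling ω)
    {i : Fin n} (hlo : ∀ a b, a < i → ω a b = []) {z : Fin d} {w : List (Fin d)}
    (hi : blockWord ω i = z :: w) :
    ∃ j ω₁ ω₂, Joinable i j ω₁ ω₂ ∧ joinLabelling i j z ω₁ ω₂ = ω ∧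
      (∀ a b, (ω₁ a b).length ≤ (ω a b).length) ∧
      ∀ a b, (ω₂ a b).length ≤ (ω a b).length := by
  have hlo' : ∀ a b, b < i → ω a b = [] := fun a b hb => by
    rw [hω.symm b a, hlo b a hb, List.reverse_nil]
  obtain ⟨j, hj, hmax⟩ : ∃ j, ω i j ≠ [] ∧ ∀ b, j < b → ω i b = [] := by
    have hne : (Finset.univ.filter fun b => ω i b ≠ []).Nonempty := by
      by_contra hne
      rw [Finset.not_nonempty_iff_eq_empty, Finset.filter_eq_empty_iff] at hne
      rw [(blockWord_eq_nil_iff hω).mpr fun b => by simpa using hne (Finset.mem_univ b)] at hi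
      exact List.cons_ne_nil _ _ hi.symm
    refine ⟨_, (Finset.mem_filter.mp (Finset.max'_mem _ hne)).2, fun b hb => ?_⟩
    by_contra hb'
    exact hb.not_ge (Finset.le_max' _ b (Finset.mem_filter.mpr ⟨Finset.mem_univ b, hb'⟩))
  have hij : i < j := by
    rcases lt_trichotomy i j with h | rfl | h
    · exact h
    · exact absurd (hω.diag i) hj
    · exact absurd (hlo' i j h) hj
  have hhead : ∃ v, ω i j = z :: v := by
    rw [blockWord, nbrOrder_eq_of_lt hij, List.map_append, List.flatten_append,
      flatten_map_eq_nil, List.nil_append, List.map_cons, List.flatten_cons] at hi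
    · obtain ⟨y, v, hv⟩ := List.exists_cons_of_ne_nil hj
      rw [hv, List.cons_append] at hi
      exact ⟨v, by rw [hv, (List.cons.inj hi).1]⟩
    · intro b hb
      rw [List.mem_append, mem_descending, mem_descending] at hb
      exact hb.elim (hlo' i b) (hmax b)
  obtain ⟨v, hv⟩ := hhead
  have hv' : ω j i = v.reverse ++ [z] := by rw [hω.symm i j, hv, List.reverse_cons]
  let ω₁ : Fin n → Fin n → List (Fin d) := fun a b =>
    if a = i ∧ b = j then v else if a = j ∧ b = i then v.reverse
    else if a ≤ j ∧ b ≤ j then ω a b else []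
  let ω₂ : Fin n → Fin n → List (Fin d) := fun a b => if j ≤ a ∧ j ≤ b then ω a b else []
  have hne₁ : ∀ a b, ω₁ a b ≠ [] → ω a b ≠ [] ∧ a ≤ j ∧ b ≤ j := by
    intro a b hab
    simp only [ω₁] at hab
    split_ifs at hab with h1 h2 h3
    · obtain ⟨rfl, rfl⟩ := h1
      exact ⟨by simp [hv], hij.le, le_rfl⟩
    · obtain ⟨rfl, rfl⟩ := h2
      exact ⟨by simp [hv'], le_rfl, hij.le⟩
    · exact ⟨hab, h3⟩
    · exact absurd rfl hab
  have hne₂ : ∀ a b, ω₂ a b ≠ [] → ω a b ≠ [] ∧ j ≤ a ∧ j ≤ b := by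
    intro a b hab
    simp only [ω₂] at hab
    split_ifs at hab with h1
    · exact ⟨hab, h1⟩
    · exact absurd rfl hab
  have hl₁ : IsLabelling ω₁ := by
    refine ⟨fun a b => ?_, fun a => ?_, fun a c b e hac hcb hbe hab => ?_⟩
    · simp only [ω₁]
      split_ifs <;> first | omega | simp [hω.symm a b]
    · by_contra h
      exact (hne₁ a a h).1 (hω.diag a)
    · by_contra h
      exact (hne₁ c e h).1 (hω.noncrossing a c b e hac hcb hbe (hne₁ a b hab).1)
  have hl₂ : IsLabelling ω₂ := by
    refine ⟨fun a b => ?_, fun a => ?_, fun a c b e hac hcb hbe hab => ?_⟩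
    · simp only [ω₂]
      split_ifs <;> first | omega | simp [hω.symm a b]
    · by_contra h
      exact (hne₂ a a h).1 (hω.diag a)
    · by_contra h
      exact (hne₂ c e h).1 (hω.noncrossing a c b e hac hcb hbe (hne₂ a b hab).1)
  have hJ : Joinable i j ω₁ ω₂ := by
    refine ⟨hij, hl₁, hl₂, fun a b ha => ?_, fun a b ha => ?_, fun a b ha => ?_⟩
    · by_contra h
      exact (hne₁ a b h).1 (hlo a b ha)
    · by_contra h
      exact ha.not_ge (hne₁ a b h).2.1
    · by_contra h
      exact ha.not_ge (hne₂ a b h).2.1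
  -- an edge that leaves `[i, j]` other than through `j` would cross the link from `i` to `j`
  have hcross : ∀ a b, a < j → j < b → ω a b = [] := by
    intro a b ha hb
    rcases lt_trichotomy a i with h | rfl | h
    · exact hlo a b h
    · exact hmax b hb
    · exact hω.noncrossing i a j b h ha hb hj
  refine ⟨j, ω₁, ω₂, hJ, ?_, fun a b => ?_, fun a b => ?_⟩
  · funext a b
    by_cases h1 : a = i ∧ b = j
    · obtain ⟨rfl, rfl⟩ := h1
      simp [Joinable.join_first, ω₁, hv]
    by_cases h2 : a = j ∧ b = i
    · obtain ⟨rfl, rfl⟩ := h2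
      simp [hJ.join_last, ω₁, hv', hij.ne']
    by_cases h3 : a ≤ j ∧ b ≤ j
    · rw [Joinable.join_left a b h1 h2 h3.1 h3.2]
      simp [ω₁, h1, h2, h3]
    · rw [hJ.join_right a b h3]
      by_cases h4 : j ≤ a ∧ j ≤ b
      · simp [ω₂, h4]
      · simp only [ω₂, if_neg h4]
        rcases le_or_gt a j with h5 | h5
        · exact (hcross a b (by omega) (by omega)).symm
        · rw [hω.symm b a, hcross b a (by omega) h5, List.reverse_nil]
  · simp only [ω₁]
    split_ifs with h1 h2 h3
    · obtain ⟨rfl, rfl⟩ := h1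
      simp [hv]
    · obtain ⟨rfl, rfl⟩ := h2
      simp [hv']
    · exact le_rfl
    · exact Nat.zero_le _
  · simp only [ω₂]
    split_ifs
    · exact le_rfl
    · exact Nat.zero_le _

end Labellings

/-! ### The expansion over labellings -/

section LinkSum

variable {n d : ℕ}

/-- The factor `∏ κ_{ab}^{|ω_{ab}|}` of a labelling, with one entry for each unordered pair. -/
noncomputable def edgeWeight (κ : Sym2 (Fin n) → ℝ) (ω : Fin n → Fin n → List (Fin d)) : ℂ :=
  ∏ p ∈ (Finset.univ : Finset (Fin n × Fin n)).filter fun p => p.1 < p.2,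
    ((κ s(p.1, p.2) : ℝ) : ℂ) ^ (ω p.1 p.2).length

/-- The expansion of `τ (A₁(x¹) ⋯ Aₙ(xⁿ))` over noncrossing labellings by words of length at
most `N`. The pairings inside each word are accounted for by the Wick coefficients. -/
noncomputable def linkSum (N : ℕ) (κ : Sym2 (Fin n) → ℝ) (A : Fin n → List (Fin d)) : ℂ :=
  ∑ ω ∈ labellings n d N, edgeWeight κ ω * ∏ i, wickCoeff (A i) (blockWord ω i)

/-- The words before the `j`-th one, followed by `u`. -/
def lowPart (A : Fin n → List (Fin d)) (j : Fin n) (u : List (Fin d)) : Fin n → List (Fin d) :=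
  fun i => if i < j then A i else if i = j then u else []

/-- The word `v`, followed by the words after the `j`-th one. -/
def highPart (A : Fin n → List (Fin d)) (j : Fin n) (v : List (Fin d)) :
    Fin n → List (Fin d) :=
  fun i => if j < i then A i else if i = j then v else []

theorem Joinable.edgeWeight_join {i j : Fin n} {z : Fin d}
    {ω₁ ω₂ : Fin n → Fin n → List (Fin d)} (h : Joinable i j ω₁ ω₂) (κ : Sym2 (Fin n) → ℝ) :
    edgeWeight κ (joinLabelling i j z ω₁ ω₂) =
      ((κ s(i, j) : ℝ) : ℂ) * (edgeWeight κ ω₁ * edgeWeight κ ω₂) := by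
  have hij := h.lt
  have hone : ((κ s(i, j) : ℝ) : ℂ) =
      ∏ p ∈ (Finset.univ : Finset (Fin n × Fin n)).filter (fun p => p.1 < p.2),
        if p = (i, j) then ((κ s(i, j) : ℝ) : ℂ) else 1 := by
    rw [Finset.prod_ite_eq' _ _ fun _ => ((κ s(i, j) : ℝ) : ℂ)]
    simp [hij]
  rw [edgeWeight, edgeWeight, edgeWeight, hone, ← Finset.prod_mul_distrib,
    ← Finset.prod_mul_distrib]
  refine Finset.prod_congr rfl fun p hp => ?_
  obtain ⟨a, b⟩ := p
  replace hp : a < b := (Finset.mem_filter.mp hp).2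
  simp only [Prod.mk.injEq]
  by_cases h1 : a = i ∧ b = j
  · obtain ⟨rfl, rfl⟩ := h1
    rw [Joinable.join_first, h.right_lo _ _ hij]
    simp [pow_succ, mul_comm]
  · rw [if_neg h1, one_mul, ← pow_add]
    congr 1
    by_cases h2 : b ≤ j
    · rw [Joinable.join_left a b h1 (by omega) (by omega) h2, h.right_lo a b (by omega)]
      rfl
    · rw [h.join_right a b (by omega), h.left_hi' a b (by omega)]
      simp

theorem wickCoeff_nil_ne_zero {w : List (Fin d)} (h : wickCoeff [] w ≠ 0) : w = [] := by
  by_contra hw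
  exact h (by rw [wickCoeff_nil, if_neg hw])

/-- The labellings in which the first letter `z` of the first nonempty word is linked to another
word: the link cuts the circle into two parts. -/
theorem sum_stripHead_eq (N : ℕ) (κ : Sym2 (Fin n) → ℝ) (A : Fin n → List (Fin d)) (i : Fin n)
    (hlo : ∀ a, a < i → A a = []) (hN : ∀ a, (A a).length < N) (z : Fin d) :
    ∑ ω ∈ labellings n d N, edgeWeight κ ω * (stripHead z (wickCoeff (A i)) (blockWord ω i) *
        ∏ a ∈ Finset.univ.erase i, wickCoeff (A a) (blockWord ω a)) =
      ∑ j ∈ Finset.univ.filter (i < ·), ((κ s(i, j) : ℝ) : ℂ) *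
        splitSum (letterIndicator z) (A j) fun u v =>
          linkSum N κ (lowPart A j u) * linkSum N κ (highPart A j v) := by
  have hterm : ∀ j, splitSum (letterIndicator z) (A j) (fun u v =>
        linkSum N κ (lowPart A j u) * linkSum N κ (highPart A j v)) =
      ∑ p ∈ labellings n d N ×ˢ labellings n d N, edgeWeight κ p.1 * edgeWeight κ p.2 *
        (wickCoeff (A j) (blockWord p.1 j ++ z :: blockWord p.2 j) *
        ∏ a ∈ Finset.univ.erase j, wickCoeff (if a < j then A a else []) (blockWord p.1 a) *
          wickCoeff (if j < a then A a else []) (blockWord p.2 a)) := by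
    intro j
    have h1 : ∀ u v, linkSum N κ (lowPart A j u) * linkSum N κ (highPart A j v) =
        ∑ p ∈ labellings n d N ×ˢ labellings n d N, edgeWeight κ p.1 * edgeWeight κ p.2 *
          (∏ a ∈ Finset.univ.erase j, wickCoeff (if a < j then A a else []) (blockWord p.1 a) *
            wickCoeff (if j < a then A a else []) (blockWord p.2 a)) *
          (wickCoeff u (blockWord p.1 j) * wickCoeff v (blockWord p.2 j)) := by
      intro u v
      rw [linkSum, linkSum, Finset.sum_mul_sum, ← Finset.sum_product']
      refine Finset.sum_congr rfl fun p _ => ?_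
      rw [← Finset.mul_prod_erase Finset.univ (fun a => wickCoeff (lowPart A j u a) _)
        (Finset.mem_univ j), ← Finset.mul_prod_erase Finset.univ
        (fun a => wickCoeff (highPart A j v a) _) (Finset.mem_univ j), Finset.prod_mul_distrib]
      have e1 : ∏ a ∈ Finset.univ.erase j, wickCoeff (lowPart A j u a) (blockWord p.1 a) =
          ∏ a ∈ Finset.univ.erase j,
            wickCoeff (if a < j then A a else []) (blockWord p.1 a) :=
        Finset.prod_congr rfl fun a ha => by simp [lowPart, Finset.ne_of_mem_erase ha]
      have e2 : ∏ a ∈ Finset.univ.erase j, wickCoeff (highPart A j v a) (blockWord p.2 a) =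
          ∏ a ∈ Finset.univ.erase j,
            wickCoeff (if j < a then A a else []) (blockWord p.2 a) :=
        Finset.prod_congr rfl fun a ha => by simp [highPart, Finset.ne_of_mem_erase ha]
      rw [e1, e2]
      simp only [lowPart, highPart, lt_irrefl, if_false, if_true]
      ring
    simp only [h1, splitSum_finsetSum]
    refine Finset.sum_congr rfl fun p _ => ?_
    rw [splitSum_mul_left, ← wickCoeff_append_cons]
    ring
  simp only [hterm, Finset.mul_sum]
  rw [← Finset.sum_product']
  -- nonzero terms on the right come from pairs of labellings that can be joined
  have hjoinable : ∀ q ∈ Finset.univ.filter (i < ·) ×ˢ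
      (labellings n d N ×ˢ labellings n d N),
      ((κ s(i, q.1) : ℝ) : ℂ) * (edgeWeight κ q.2.1 * edgeWeight κ q.2.2 *
        (wickCoeff (A q.1) (blockWord q.2.1 q.1 ++ z :: blockWord q.2.2 q.1) *
        ∏ a ∈ Finset.univ.erase q.1,
          wickCoeff (if a < q.1 then A a else []) (blockWord q.2.1 a) *
          wickCoeff (if q.1 < a then A a else []) (blockWord q.2.2 a))) ≠ 0 →
      Joinable i q.1 q.2.1 q.2.2 := by
    rintro ⟨j, ω₁, ω₂⟩ hq hne
    simp only [Finset.mem_product, Finset.mem_filter, Finset.mem_univ, true_and,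
      mem_labellings] at hq
    obtain ⟨hij, ⟨-, hω₁⟩, -, hω₂⟩ := hq
    have hprod := right_ne_zero_of_mul (right_ne_zero_of_mul (right_ne_zero_of_mul hne))
    rw [Finset.prod_ne_zero_iff] at hprod
    have hp₁ : ∀ a ≠ j, wickCoeff (if a < j then A a else []) (blockWord ω₁ a) ≠ 0 :=
      fun a ha => left_ne_zero_of_mul
        (hprod a (Finset.mem_erase.mpr ⟨ha, Finset.mem_univ a⟩))
    have hp₂ : ∀ a ≠ j, wickCoeff (if j < a then A a else []) (blockWord ω₂ a) ≠ 0 :=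
      fun a ha => right_ne_zero_of_mul
        (hprod a (Finset.mem_erase.mpr ⟨ha, Finset.mem_univ a⟩))
    refine ⟨hij, hω₁, hω₂, fun a b ha => ?_, fun a b ha => ?_, fun a b ha => ?_⟩
    · have := hp₁ a (ha.trans hij).ne
      rw [if_pos (ha.trans hij), hlo a ha] at this
      exact (blockWord_eq_nil_iff hω₁).mp (wickCoeff_nil_ne_zero this) b
    · have := hp₁ a ha.ne'
      rw [if_neg ha.not_gt] at this
      exact (blockWord_eq_nil_iff hω₁).mp (wickCoeff_nil_ne_zero this) b
    · have := hp₂ a ha.ne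
      rw [if_neg ha.not_gt] at this
      exact (blockWord_eq_nil_iff hω₂).mp (wickCoeff_nil_ne_zero this) b
  have hvalue : ∀ j ω₁ ω₂, Joinable i j ω₁ ω₂ →
      ((κ s(i, j) : ℝ) : ℂ) * (edgeWeight κ ω₁ * edgeWeight κ ω₂ *
        (wickCoeff (A j) (blockWord ω₁ j ++ z :: blockWord ω₂ j) *
        ∏ a ∈ Finset.univ.erase j,
          wickCoeff (if a < j then A a else []) (blockWord ω₁ a) *
          wickCoeff (if j < a then A a else []) (blockWord ω₂ a))) =
      edgeWeight κ (joinLabelling i j z ω₁ ω₂) *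
        (stripHead z (wickCoeff (A i)) (blockWord (joinLabelling i j z ω₁ ω₂) i) *
        ∏ a ∈ Finset.univ.erase i,
          wickCoeff (A a) (blockWord (joinLabelling i j z ω₁ ω₂) a)) := by
    intro j ω₁ ω₂ h
    have hij := h.lt
    have hji : j ∈ Finset.univ.erase i := Finset.mem_erase.mpr ⟨hij.ne', Finset.mem_univ j⟩
    have hij' : i ∈ Finset.univ.erase j := Finset.mem_erase.mpr ⟨hij.ne, Finset.mem_univ i⟩
    rw [h.edgeWeight_join, h.blockWord_join_first, stripHead_cons, if_pos rfl,
      ← Finset.mul_prod_erase _ _ hji, ← Finset.mul_prod_erase _ _ hij', h.blockWord_join_last,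
      if_pos hij, if_neg hij.not_gt, (blockWord_eq_nil_iff h.right).mpr
      (fun b => h.right_lo i b hij), Finset.erase_right_comm]
    have hprod : ∏ a ∈ (Finset.univ.erase i).erase j,
        wickCoeff (if a < j then A a else []) (blockWord ω₁ a) *
          wickCoeff (if j < a then A a else []) (blockWord ω₂ a) =
        ∏ a ∈ (Finset.univ.erase i).erase j,
          wickCoeff (A a) (blockWord (joinLabelling i j z ω₁ ω₂) a) := by
      refine Finset.prod_congr rfl fun a ha => ?_
      have haj : a ≠ j := Finset.ne_of_mem_erase ha
      have hai : a ≠ i := Finset.ne_of_mem_erase (Finset.mem_of_mem_erase ha)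
      rcases lt_or_gt_of_ne haj with haj | haj
      · rw [h.blockWord_join_left hai haj, if_pos haj, if_neg haj.not_gt,
          (blockWord_eq_nil_iff h.right).mpr (fun b => h.right_lo a b haj), wickCoeff_nil,
          if_pos rfl, mul_one]
      · rw [h.blockWord_join_right haj, if_neg haj.not_gt, if_pos haj,
          (blockWord_eq_nil_iff h.left).mpr (fun b => h.left_hi a b haj), wickCoeff_nil,
          if_pos rfl, one_mul]
    rw [hprod, wickCoeff_nil, if_pos rfl]
    ring
  symm
  refine Finset.sum_bij_ne_zero (fun q _ _ => joinLabelling i q.1 z q.2.1 q.2.2) ?_ ?_ ?_ ?_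
  · intro q hq hne
    have h := hjoinable q hq hne
    refine mem_labellings.mpr ⟨fun a b => ?_, h.isLabelling⟩
    have hne' := hne
    rw [hvalue _ _ _ h] at hne'
    refine (length_le_blockWord h.isLabelling a b).trans ?_
    have hne' := right_ne_zero_of_mul hne'
    by_cases ha : a = i
    · subst ha
      have := left_ne_zero_of_mul hne'
      rw [h.blockWord_join_first, stripHead_cons, if_pos rfl] at this
      have := length_le_of_wickCoeff_ne_zero this
      rw [h.blockWord_join_first, List.length_cons]
      exact this.trans_lt (hN a)
    · have := right_ne_zero_of_mul hne'
      rw [Finset.prod_ne_zero_iff] at this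
      exact (length_le_of_wickCoeff_ne_zero
        (this a (Finset.mem_erase.mpr ⟨ha, Finset.mem_univ a⟩))).trans (hN a).le
  · rintro ⟨j, ω₁, ω₂⟩ hq hne ⟨j', ω₁', ω₂'⟩ hq' hne' e
    obtain ⟨rfl, rfl, rfl⟩ := (hjoinable _ hq hne).join_injective (hjoinable _ hq' hne') e
    rfl
  · intro ω hω hne
    rw [mem_labellings] at hω
    have hne' := right_ne_zero_of_mul hne
    have hlo' : ∀ a b, a < i → ω a b = [] := by
      intro a b ha
      have := right_ne_zero_of_mul hne'
      rw [Finset.prod_ne_zero_iff] at this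
      have := this a (Finset.mem_erase.mpr ⟨ha.ne, Finset.mem_univ a⟩)
      rw [hlo a ha] at this
      exact (blockWord_eq_nil_iff hω.2).mp (wickCoeff_nil_ne_zero this) b
    obtain ⟨w, hw⟩ : ∃ w, blockWord ω i = z :: w := by
      have := left_ne_zero_of_mul hne'
      rcases hb : blockWord ω i with _ | ⟨y, w⟩
      · simp [hb] at this
      · rw [hb, stripHead_cons] at this
        by_cases hy : y = z
        · exact ⟨w, by rw [hy]⟩
        · simp [hy] at this
    obtain ⟨j, ω₁, ω₂, hJ, rfl, hl₁, hl₂⟩ := hω.2.exists_join hlo' hw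
    refine ⟨(j, ω₁, ω₂), ?_, ?_, rfl⟩
    · simp only [Finset.mem_product, Finset.mem_filter, Finset.mem_univ, true_and,
        mem_labellings]
      exact ⟨hJ.lt, ⟨fun a b => (hl₁ a b).trans (hω.1 a b), hJ.left⟩,
        fun a b => (hl₂ a b).trans (hω.1 a b), hJ.right⟩
    · rwa [← hvalue j ω₁ ω₂ hJ] at hne
  · intro q hq hne
    exact hvalue _ _ _ (hjoinable q hq hne)

theorem isLabelling_nil : IsLabelling fun _ _ : Fin n => ([] : List (Fin d)) :=
  ⟨fun _ _ => rfl, fun _ => rfl, fun _ _ _ _ _ _ _ _ => rfl⟩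

/-- A single word has no links. -/
theorem linkSum_eq_wickCoeff (N : ℕ) (κ : Sym2 (Fin n) → ℝ) (A : Fin n → List (Fin d))
    (i : Fin n) (hA : ∀ a, a ≠ i → A a = []) : linkSum N κ A = wickCoeff (A i) [] := by
  rw [linkSum, Finset.sum_eq_single fun _ _ => []]
  · have h : ∀ a, blockWord (fun _ _ : Fin n => ([] : List (Fin d))) a = [] :=
      fun a => flatten_map_eq_nil fun _ _ => rfl
    rw [Finset.prod_eq_single i]
    · simp [edgeWeight, h]
    · intro a _ ha
      rw [hA a ha, h, wickCoeff_nil, if_pos rfl]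
    · simp
  · intro ω hω hne
    rw [mem_labellings] at hω
    by_contra h
    have hprod := right_ne_zero_of_mul h
    rw [Finset.prod_ne_zero_iff] at hprod
    have hnil : ∀ a, a ≠ i → ∀ b, ω a b = [] := by
      intro a ha b
      have := hprod a (Finset.mem_univ a)
      rw [hA a ha] at this
      exact (blockWord_eq_nil_iff hω.2).mp (wickCoeff_nil_ne_zero this) b
    refine hne (funext fun a => funext fun b => ?_)
    by_cases ha : a = i
    · by_cases hb : b = i
      · rw [ha, hb, hω.2.diag]
      · rw [hω.2.symm b a, hnil b hb, List.reverse_nil]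
    · exact hnil a ha b
  · intro h
    exact absurd (mem_labellings.mpr ⟨fun _ _ => Nat.zero_le _, isLabelling_nil⟩) h

theorem linkSum_nil (N : ℕ) (κ : Sym2 (Fin n) → ℝ) :
    linkSum N κ (fun _ => ([] : List (Fin d))) = 1 := by
  rcases n with _ | n
  · rw [linkSum, Finset.sum_eq_single fun _ _ => []]
    · simp [edgeWeight]
    · intro ω _ hω
      exact absurd (funext fun a => a.elim0) hω
    · intro h
      exact absurd (mem_labellings.mpr ⟨fun _ _ => Nat.zero_le _, isLabelling_nil⟩) h
  · rw [linkSum_eq_wickCoeff N κ _ 0 fun _ _ => rfl, wickCoeff_nil, if_pos rfl]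

theorem splitSum_nil_word {α : Type*} (g : α → ℂ) (f : List α → List α → ℂ) :
    splitSum g [] f = 0 := rfl

/-- The Schwinger–Dyson equation for the expansion over labellings. -/
theorem linkSum_recursion (N : ℕ) (κ : Sym2 (Fin n) → ℝ) (A : Fin n → List (Fin d)) (i : Fin n)
    (hκ : κ s(i, i) = 1) (hlo : ∀ a, a < i → A a = []) (hN : ∀ a, (A a).length < N)
    (z : Fin d) (A' : List (Fin d)) (hA : A i = z :: A') :
    linkSum N κ A = ∑ j, ((κ s(i, j) : ℝ) : ℂ) *
      splitSum (letterIndicator z) (Function.update A i A' j) fun u v =>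
        linkSum N κ (lowPart (Function.update A i A') j u) *
          linkSum N κ (highPart (Function.update A i A') j v) := by
  have hu : ∀ a, a ≠ i → Function.update A i A' a = A a :=
    fun a ha => Function.update_of_ne ha _ _
  have hui : Function.update A i A' i = A' := Function.update_self _ _ _
  have hlen : A'.length < N := by
    have := hN i
    rw [hA, List.length_cons] at this
    omega
  have hstrip := sum_stripHead_eq N κ (Function.update A i A') i
    (fun a ha => by rw [hu a ha.ne, hlo a ha])
    (fun a => by
      by_cases ha : a = i
      · rw [ha, hui]; exact hlen
      · rw [hu a ha]; exact hN a) z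
  rw [← Finset.sum_filter_add_sum_filter_not Finset.univ (i < ·), ← hstrip,
    Finset.sum_eq_single i, hκ, hui, Complex.ofReal_one, one_mul]
  · have hlow : ∀ u, linkSum N κ (lowPart (Function.update A i A') i u) = wickCoeff u [] := by
      intro u
      rw [linkSum_eq_wickCoeff N κ _ i]
      · simp [lowPart]
      · intro a ha
        rcases lt_or_gt_of_ne ha with h | h
        · rw [lowPart, if_pos h, hu a ha, hlo a h]
        · rw [lowPart, if_neg h.not_gt, if_neg ha]
    have hhigh : ∀ v, linkSum N κ (highPart (Function.update A i A') i v) =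
        ∑ ω ∈ labellings n d N, edgeWeight κ ω * (∏ a ∈ Finset.univ.erase i,
          wickCoeff (A a) (blockWord ω a)) * wickCoeff v (blockWord ω i) := by
      intro v
      refine Finset.sum_congr rfl fun ω _ => ?_
      rw [← Finset.mul_prod_erase Finset.univ _ (Finset.mem_univ i), mul_assoc,
        mul_comm (∏ a ∈ _, _)]
      congr 2
      · simp [highPart]
      · refine Finset.prod_congr rfl fun a ha => ?_
        have ha := Finset.ne_of_mem_erase ha
        rcases lt_or_gt_of_ne ha with h | h
        · rw [highPart, if_neg h.not_gt, if_neg ha, hlo a h]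
        · rw [highPart, if_pos h, hu a ha]
    simp only [hlow, hhigh, Finset.mul_sum, splitSum_finsetSum]
    rw [linkSum, ← Finset.sum_add_distrib]
    refine Finset.sum_congr rfl fun ω _ => ?_
    have hprod : ∏ a ∈ Finset.univ.erase i,
        wickCoeff (Function.update A i A' a) (blockWord ω a) =
        ∏ a ∈ Finset.univ.erase i, wickCoeff (A a) (blockWord ω a) :=
      Finset.prod_congr rfl fun a ha => by rw [hu a (Finset.ne_of_mem_erase ha)]
    rw [← Finset.mul_prod_erase Finset.univ _ (Finset.mem_univ i), hA,
      wickCoeff_cons_eq_splitSum, hprod, add_mul, mul_add]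
    congr 1
    rw [mul_comm (splitSum _ _ _), ← mul_assoc, ← splitSum_mul_left]
    exact splitSum_congr fun _ _ _ _ => by ring
  · intro a ha hai
    have hai' : a < i := lt_of_le_of_ne (not_lt.mp (Finset.mem_filter.mp ha).2) hai
    rw [hu a hai, hlo a hai', splitSum_nil_word, mul_zero]
  · intro h
    exact absurd (Finset.mem_filter.mpr ⟨Finset.mem_univ i, lt_irrefl i⟩) h

theorem length_lowPart_le {A : Fin n → List (Fin d)} {j : Fin n} {u : List (Fin d)}
    (hu : u.length ≤ (A j).length) (a : Fin n) :
    (lowPart A j u a).length ≤ (A a).length := by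
  unfold lowPart
  split_ifs with h1 h2
  · exact le_rfl
  · exact h2 ▸ hu
  · exact Nat.zero_le _

theorem length_highPart_le {A : Fin n → List (Fin d)} {j : Fin n} {v : List (Fin d)}
    (hv : v.length ≤ (A j).length) (a : Fin n) :
    (highPart A j v a).length ≤ (A a).length := by
  unfold highPart
  split_ifs with h1 h2
  · exact le_rfl
  · exact h2 ▸ hv
  · exact Nat.zero_le _

/-- The Schwinger–Dyson equation determines a function of `n` words. -/
theorem eq_linkSum (N : ℕ) (κ : Sym2 (Fin n) → ℝ) (hκ : d ≠ 0 → ∀ i, κ s(i, i) = 1)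
    (t : (Fin n → List (Fin d)) → ℂ) (h0 : t (fun _ => []) = 1)
    (ht : ∀ (A : Fin n → List (Fin d)) (i : Fin n) (z : Fin d) (A' : List (Fin d)),
      (∀ a, a < i → A a = []) → A i = z :: A' →
      t A = ∑ j, ((κ s(i, j) : ℝ) : ℂ) *
        splitSum (letterIndicator z) (Function.update A i A' j) fun u v =>
          t (lowPart (Function.update A i A') j u) *
            t (highPart (Function.update A i A') j v))
    (A : Fin n → List (Fin d)) (hN : ∀ a, (A a).length < N) : t A = linkSum N κ A := by
  induction hm : ∑ a, (A a).length using Nat.strong_induction_on generalizing A with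
  | _ m ih =>
  by_cases hA : ∀ a, A a = []
  · obtain rfl : A = fun _ => [] := funext hA
    rw [h0, linkSum_nil]
  · obtain ⟨i, hi, hmin⟩ : ∃ i, A i ≠ [] ∧ ∀ a, a < i → A a = [] := by
      have hne : (Finset.univ.filter fun a => A a ≠ []).Nonempty := by
        push Not at hA
        obtain ⟨a, ha⟩ := hA
        exact ⟨a, Finset.mem_filter.mpr ⟨Finset.mem_univ a, ha⟩⟩
      refine ⟨_, (Finset.mem_filter.mp (Finset.min'_mem _ hne)).2, fun a ha => ?_⟩
      by_contra h
      exact ha.not_ge (Finset.min'_le _ a (Finset.mem_filter.mpr ⟨Finset.mem_univ a, h⟩))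
    obtain ⟨z, A', hA'⟩ := List.exists_cons_of_ne_nil hi
    have hd : d ≠ 0 := fun h => (h ▸ z : Fin 0).elim0
    rw [ht A i z A' hmin hA', linkSum_recursion N κ A i (hκ hd i) hmin hN z A' hA']
    have hle : ∀ a, (Function.update A i A' a).length ≤ (A a).length := by
      intro a
      by_cases ha : a = i
      · subst ha
        rw [Function.update_self, hA', List.length_cons]
        exact Nat.le_succ _
      · rw [Function.update_of_ne ha]
    have hlt : ∑ a, (Function.update A i A' a).length < m := by
      rw [← hm]
      refine Finset.sum_lt_sum (fun a _ => hle a) ⟨i, Finset.mem_univ i, ?_⟩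
      rw [Function.update_self, hA', List.length_cons]
      exact Nat.lt_succ_self _
    have hih : ∀ B : Fin n → List (Fin d),
        (∀ a, (B a).length ≤ (Function.update A i A' a).length) → t B = linkSum N κ B :=
      fun B hB => ih _ ((Finset.sum_le_sum fun a _ => hB a).trans_lt hlt) B
        (fun a => ((hB a).trans (hle a)).trans_lt (hN a)) rfl
    refine Finset.sum_congr rfl fun j _ => ?_
    congr 1
    refine splitSum_congr fun u y v huv => ?_
    rw [hih _ (length_lowPart_le _), hih _ (length_highPart_le _)]
    · rw [huv]; simp; omega
    · rw [huv]; simp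

end LinkSum

/-! ### Mixed moments -/

section Moments

variable {𝒜 : Type*} [CStarAlgebra 𝒜] {τ : 𝒜 →ₗ[ℂ] ℂ} {n d : ℕ}

/-- The mixed moment `τ (A₁(x¹) ⋯ Aₙ(xⁿ))`. -/
noncomputable def moment (τ : 𝒜 →ₗ[ℂ] ℂ) (x : Fin n → Fin d → 𝒜)
    (A : Fin n → List (Fin d)) : ℂ :=
  τ (List.ofFn fun i => evalMonomial (A i) (x i)).prod

theorem moment_eq_flatten (x : Fin n → Fin d → 𝒜) (A : Fin n → List (Fin d)) :
    moment τ x A = τ (List.ofFn fun i => (A i).map (x i)).flatten.prod := by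
  rw [moment, List.prod_flatten, List.map_ofFn]
  rfl

theorem moment_recursion (hτ : IsCStarProbabilitySpace τ) {x : Fin n → Fin d → 𝒜}
    {κ : Sym2 (Fin n) → ℝ} (hjoint : IsJointlySemicircular τ fun p : Fin n × Fin d => x p.1 p.2)
    (hcov : ∀ (i j : Fin n) (u v : Fin d),
      τ (x i u * x j v) = if u = v then ((κ s(i, j) : ℝ) : ℂ) else 0)
    (A : Fin n → List (Fin d)) (i : Fin n) (z : Fin d) (A' : List (Fin d))
    (hlo : ∀ a, a < i → A a = []) (hA : A i = z :: A') :
    moment τ x A = ∑ j, ((κ s(i, j) : ℝ) : ℂ) *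
      splitSum (letterIndicator z) (Function.update A i A' j) fun u v =>
        moment τ x (lowPart (Function.update A i A') j u) *
          moment τ x (highPart (Function.update A i A') j v) := by
  obtain ⟨m, s, hs, hx⟩ := hjoint
  have hfirst : ∀ {n : ℕ} (i : Fin n) (L L' : Fin n → List 𝒜) (y : 𝒜),
      (∀ a, a < i → L a = []) → L i = y :: L' i → (∀ a, a ≠ i → L a = L' a) →
      (List.ofFn L).flatten = y :: (List.ofFn L').flatten := by
    intro n i L L' y h1 h2 h3
    induction n with
    | zero => exact i.elim0
    | succ n ih =>
      rw [List.ofFn_succ, List.ofFn_succ, List.flatten_cons, List.flatten_cons]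
      induction i using Fin.cases with
      | zero =>
        rw [h2, List.cons_append]
        congr 3
        exact congr_arg _ (funext fun a => h3 _ (Fin.succ_ne_zero a))
      | succ i =>
        rw [← h3 0 (Fin.succ_ne_zero i).symm, h1 0 (Fin.succ_pos i), List.nil_append,
          List.nil_append]
        exact ih i _ _ (fun a ha => h1 _ (Fin.succ_lt_succ_iff.mpr ha)) h2
          fun a ha => h3 _ fun e => ha (Fin.succ_injective _ e)
  rw [moment_eq_flatten, hfirst i (fun a => (A a).map (x a))
    (fun a => (Function.update A i A' a).map (x a)) (x i z) (fun a ha => by simp [hlo a ha])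
    (by simp [hA]) (fun a ha => by simp [ha]), List.prod_cons,
    map_mul_prod_eq_dysonSum hτ hs _ (hx (i, z)), dysonSum, splitSum_flatten_ofFn]
  · refine Finset.sum_congr rfl fun j _ => ?_
    rw [splitSum_map, ← splitSum_mul_weight]
    refine splitSum_congr fun u y v _ => ?_
    rw [moment_eq_flatten, moment_eq_flatten]
    have h1 : (List.ofFn fun a => if a < j then (Function.update A i A' a).map (x a)
          else if a = j then u.map (x j) else []) =
        List.ofFn fun a => (lowPart (Function.update A i A') j u a).map (x a) := by
      congr 1
      funext a
      unfold lowPart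
      split_ifs with h1 h2
      · rfl
      · rw [h2]
      · rfl
    have h2 : (List.ofFn fun a => if j < a then (Function.update A i A' a).map (x a)
          else if a = j then v.map (x j) else []) =
        List.ofFn fun a => (highPart (Function.update A i A') j v a).map (x a) := by
      congr 1
      funext a
      unfold highPart
      split_ifs with h1 h2
      · rfl
      · rw [h2]
      · rfl
    rw [h1, h2]
    congr 1
    simp only [Function.comp, hcov, letterIndicator, eq_comm (a := z)]
    split_ifs <;> simp
  · intro y hy
    rw [List.mem_flatten] at hy
    obtain ⟨l, hl, hy⟩ := hy
    rw [List.mem_ofFn] at hl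
    obtain ⟨a, rfl⟩ := hl
    obtain ⟨u, -, rfl⟩ := List.mem_map.mp hy
    exact hx (a, u)

/-- The moment as a sum over noncrossing labellings. -/
theorem moment_eq_linkSum (hτ : IsCStarProbabilitySpace τ) {x : Fin n → Fin d → 𝒜}
    {κ : Sym2 (Fin n) → ℝ} (hsemi : ∀ i u, IsSemicircular τ (x i u))
    (hjoint : IsJointlySemicircular τ fun p : Fin n × Fin d => x p.1 p.2)
    (hcov : ∀ (i j : Fin n) (u v : Fin d),
      τ (x i u * x j v) = if u = v then ((κ s(i, j) : ℝ) : ℂ) else 0)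
    (A : Fin n → List (Fin d)) (N : ℕ) (hN : ∀ a, (A a).length < N) :
    moment τ x A = linkSum N κ A := by
  refine eq_linkSum N κ (fun hd i => ?_) _ ?_
    (fun A i z A' => moment_recursion hτ hjoint hcov A i z A') A hN
  · have h := hcov i i ⟨0, Nat.pos_of_ne_zero hd⟩ ⟨0, Nat.pos_of_ne_zero hd⟩
    rw [(hsemi i _).map_sq hτ, if_pos rfl] at h
    exact_mod_cast h.symm
  · simp [moment, evalMonomial, hτ.map_one]

/-- The Cauchy–Schwarz inequality for the covariances. -/
theorem abs_covariance_le_one (hτ : IsCStarProbabilitySpace τ) {x y : 𝒜}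
    (hx : IsSemicircular τ x) (hy : IsSemicircular τ y) {c : ℝ} (hc : τ (x * y) = c) :
    |c| ≤ 1 := by
  have hc' : τ (y * x) = c := by rw [hτ.tracial, hc]
  have h1 := hτ.nonneg (x + y)
  have h2 := hτ.nonneg (x - y)
  rw [star_add, hx.1.star_eq, hy.1.star_eq] at h1
  rw [star_sub, hx.1.star_eq, hy.1.star_eq] at h2
  simp only [add_mul, mul_add, map_add, hx.map_sq hτ, hy.map_sq hτ, hc, hc'] at h1
  simp only [sub_mul, mul_sub, map_sub, hx.map_sq hτ, hy.map_sq hτ, hc, hc'] at h2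
  have h1' : (0 : ℝ) ≤ 1 + c + (c + 1) := by exact_mod_cast h1
  have h2' : (0 : ℝ) ≤ 1 - c - (c - 1) := by exact_mod_cast h2
  rw [abs_le]
  constructor <;> linarith

end Moments

/-! ### Cut points of a single word -/

section CutPoints

variable {n d : ℕ}

/-- `stripLast` for the `b`-th letter of `A`, `1 ≤ b ≤ A.length` (zero for other values of `b`). -/
def stripLetter (A : List (Fin d)) (b : ℕ) (f : List (Fin d) → ℂ) (w : List (Fin d)) : ℂ :=
  if h : 1 ≤ b ∧ b ≤ A.length then stripLast (A.get ⟨b - 1, by omega⟩) f w else 0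

/-- The coefficient of the word `w` of links to `j` in the piece of `A` that is cut out for `j`.
Here `pr j` is the point whose piece comes before that of `j`, and `l` is the point whose piece
comes last. All pieces but the last one end with a linked letter. -/
def pieceCoeff (A : List (Fin d)) (pr : Fin n → Fin n) (l : Fin n) (k : Fin n → ℕ) (j : Fin n)
    (w : List (Fin d)) : ℂ :=
  if j = l then wickCoeff (pieceIoc A (k (pr j)) (k j)) w
  else stripLetter A (k j) (wickCoeff (pieceIoo A (k (pr j)) (k j))) w

theorem pieceIoc_length (A : List (Fin d)) (s : ℕ) : pieceIoc A s A.length = A.drop s := by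
  rw [pieceIoc, List.take_length]

/-- Cutting a word after the last letter linked to the first neighbour. -/
theorem wickCoeff_drop_append (A : List (Fin d)) (s : ℕ) {u v : List (Fin d)} (hu : u ≠ [])
    (hv : v ≠ []) : wickCoeff (A.drop s) (u ++ v) =
      ∑ m ∈ Finset.Ioo s A.length, stripLetter A m (wickCoeff (pieceIoo A s m)) u *
        wickCoeff (A.drop m) v := by
  obtain ⟨u, z, rfl⟩ := (List.eq_nil_or_concat u).resolve_left hu
  have hsub : Finset.Ioo s A.length ⊆ Finset.Ioc s A.length := fun m hm => by
    rw [Finset.mem_Ioo] at hm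
    exact Finset.mem_Ioc.mpr ⟨hm.1, hm.2.le⟩
  rw [List.concat_eq_append, List.append_assoc, List.singleton_append, wickCoeff_append_cons,
    splitSum_eq_sum_range, Finset.sum_subset hsub]
  · refine Finset.sum_nbij' (fun p => s + p + 1) (fun m => m - s - 1) ?_ ?_ ?_ ?_ ?_
    · intro p hp
      simp only [List.length_drop, Finset.mem_range, Finset.mem_Ioc] at hp ⊢
      omega
    · intro m hm
      simp only [List.length_drop, Finset.mem_range, Finset.mem_Ioc] at hm ⊢
      omega
    · intro p _
      omega
    · intro m hm
      rw [Finset.mem_Ioc] at hm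
      omega
    · intro p hp
      simp only [List.length_drop, Finset.mem_range] at hp
      have hp' : s + p < A.length := by omega
      have h1 : 1 ≤ s + p + 1 ∧ s + p + 1 ≤ A.length := by omega
      have e1 : (A.drop s)[p]? = some A[s + p] := by
        rw [List.getElem?_drop, List.getElem?_eq_getElem hp']
      have e2 : pieceIoo A s (s + p + 1) = (A.drop s).take p := by
        rw [pieceIoo, Nat.add_sub_cancel, List.drop_take, Nat.add_sub_cancel_left]
      have e3 : A.get ⟨s + p + 1 - 1, by omega⟩ = A[s + p] := by
        simp only [List.get_eq_getElem, Nat.add_sub_cancel]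
      rw [stripLetter, dif_pos h1, stripLast_concat, e1, e2, e3, List.drop_drop, ← mul_assoc,
        ← Nat.add_assoc, Option.elim, letterIndicator]
      simp only [eq_comm (a := z)]
      split_ifs <;> simp
  · intro m hm hm'
    obtain rfl : m = A.length := by
      rw [Finset.mem_Ioc] at hm
      rw [Finset.mem_Ioo] at hm'
      omega
    rw [List.drop_length, wickCoeff_nil, if_neg hv, mul_zero]

/-- `k` is a system of cut points for the pieces that belong to the points of `L`, in a word of
length `N` whose first `s` letters have been cut off for earlier points, the last one of which
is `p`. -/
def IsCutRow (N : ℕ) (pr : Fin n → Fin n) (l p : Fin n) (s : ℕ) (L : List (Fin n))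
    (k : Fin n → ℕ) : Prop :=
  k p = s ∧ (∀ j, j ∉ p :: L → k j = 0) ∧
    ∀ j ∈ L, (j = l → k j = N) ∧ (j ≠ l → k (pr j) < k j ∧ k j < N)

open Classical in
/-- The finite set of the systems of cut points of one word. -/
noncomputable def cutRows (N : ℕ) (pr : Fin n → Fin n) (l p : Fin n) (s : ℕ)
    (L : List (Fin n)) : Finset (Fin n → ℕ) :=
  (Fintype.piFinset fun _ => Finset.range (N + 1)).filter (IsCutRow N pr l p s L)

theorem mem_cutRows {N : ℕ} {pr : Fin n → Fin n} {l p : Fin n} {s : ℕ} (hs : s ≤ N)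
    {L : List (Fin n)} {k : Fin n → ℕ} :
    k ∈ cutRows N pr l p s L ↔ IsCutRow N pr l p s L k := by
  simp only [cutRows, Finset.mem_filter, Fintype.mem_piFinset, Finset.mem_range,
    and_iff_right_iff_imp]
  rintro ⟨h1, h2, h3⟩ j
  by_cases hj : j ∈ p :: L
  · rcases List.mem_cons.mp hj with rfl | hj
    · omega
    · by_cases hl : j = l
      · have := (h3 j hj).1 hl
        omega
      · have := (h3 j hj).2 hl
        omega
  · have := h2 j hj
    omega

theorem mem_of_isChain {pr : Fin n → Fin n} {p : Fin n} {L : List (Fin n)}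
    (h : (p :: L).IsChain fun a b => pr b = a) {b : Fin n} (hb : b ∈ L) : pr b ∈ p :: L := by
  induction L generalizing p with
  | nil => simp at hb
  | cons j L ih =>
    rw [List.isChain_cons_cons] at h
    rcases List.mem_cons.mp hb with rfl | hb
    · rw [h.1]
      exact List.mem_cons_self
    · exact List.mem_cons_of_mem _ (ih h.2 hb)

/-- The coefficient of a concatenation of nonempty words, as a sum over cut points. -/
theorem sum_cutRows (A : List (Fin d)) (ω : Fin n → List (Fin d)) (pr : Fin n → Fin n)
    (l : Fin n) (L : List (Fin n)) (p : Fin n) (s : ℕ) (hnodup : (p :: L).Nodup)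
    (hchain : (p :: L).IsChain fun a b => pr b = a) (hlast : L.getLast? = some l)
    (hs : s ≤ A.length) (hω : ∀ j ∈ L, ω j ≠ []) :
    ∑ k ∈ cutRows A.length pr l p s L, (L.map fun j => pieceCoeff A pr l k j (ω j)).prod =
      wickCoeff (A.drop s) (L.map ω).flatten := by
  induction L generalizing p s with
  | nil => simp at hlast
  | cons j L ih =>
    rw [List.isChain_cons_cons] at hchain
    have hpj : p ≠ j := fun h => (List.nodup_cons.mp hnodup).1 (h ▸ List.mem_cons_self)
    rcases L with _ | ⟨j', L⟩
    · obtain rfl : j = l := by simpa using hlast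
      rw [Finset.sum_eq_single fun b => if b = p then s else if b = j then A.length else 0]
      · simp [pieceCoeff, hchain.1, hpj.symm, pieceIoc_length]
      · intro k hk hne
        obtain ⟨h1, h2, h3⟩ := (mem_cutRows hs).mp hk
        refine absurd (funext fun b => ?_) hne
        by_cases hb : b = p
        · simp [hb, h1]
        by_cases hb' : b = j
        · subst hb'
          simp [hb, (h3 b List.mem_cons_self).1 rfl]
        · simp only [hb, hb', if_false]
          exact h2 b (by simp [hb, hb'])
      · intro h
        refine absurd ((mem_cutRows hs).mpr ⟨by simp, ?_, ?_⟩) h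
        · intro b hb
          simp only [List.mem_cons, not_or] at hb
          simp [hb.1, hb.2]
        · intro b hb
          obtain rfl : b = j := by simpa using hb
          simp [hpj.symm]
    · have hjl : j ≠ l := by
        rintro rfl
        rw [List.getLast?_cons_cons] at hlast
        exact (List.nodup_cons.mp (List.nodup_cons.mp hnodup).2).1
          (List.mem_of_getLast? hlast)
      have hp : p ∉ j :: j' :: L := (List.nodup_cons.mp hnodup).1
      have hpr : ∀ b ∈ j' :: L, pr b ≠ p := fun b hb h =>
        hp (h ▸ mem_of_isChain hchain.2 hb)
      have hne : ∀ b ∈ j :: j' :: L, b ≠ p := fun b hb h => hp (h ▸ hb)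
      have hrest : ((j' :: L).map ω).flatten ≠ [] := by
        have := hω j' (by simp)
        simp [this]
      rw [List.map_cons, List.flatten_cons, wickCoeff_drop_append A s (hω j List.mem_cons_self)
        hrest]
      have hih : ∀ m ∈ Finset.Ioo s A.length,
          stripLetter A m (wickCoeff (pieceIoo A s m)) (ω j) *
            wickCoeff (A.drop m) ((j' :: L).map ω).flatten =
          ∑ k ∈ cutRows A.length pr l j m (j' :: L),
            stripLetter A m (wickCoeff (pieceIoo A s m)) (ω j) *
              ((j' :: L).map fun b => pieceCoeff A pr l k b (ω b)).prod := by
        intro m hm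
        rw [← ih j m (List.nodup_cons.mp hnodup).2 hchain.2
          (by rwa [List.getLast?_cons_cons] at hlast) (Finset.mem_Ioo.mp hm).2.le
          (fun b hb => hω b (List.mem_cons_of_mem _ hb)), Finset.mul_sum]
      rw [Finset.sum_congr rfl hih, Finset.sum_sigma']
      refine Finset.sum_nbij' (fun k => ⟨k j, Function.update k p 0⟩)
        (fun q => Function.update q.2 p s) ?_ ?_ ?_ ?_ ?_
      · intro k hk
        obtain ⟨h1, h2, h3⟩ := (mem_cutRows hs).mp hk
        have hj := (h3 j List.mem_cons_self).2 hjl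
        rw [hchain.1, h1] at hj
        refine Finset.mem_sigma.mpr ⟨Finset.mem_Ioo.mpr hj, (mem_cutRows hj.2.le).mpr
          ⟨Function.update_of_ne hpj.symm _ _, fun b hb => ?_, fun b hb => ?_⟩⟩
        · dsimp only
          by_cases hbp : b = p
          · rw [hbp, Function.update_self]
          · rw [Function.update_of_ne hbp]
            exact h2 b (by simpa [hbp] using hb)
        · dsimp only
          rw [Function.update_of_ne (hne b (List.mem_cons_of_mem _ hb)),
            Function.update_of_ne (hpr b hb)]
          exact h3 b (List.mem_cons_of_mem _ hb)
      · rintro ⟨m, k⟩ hq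
        obtain ⟨hm, hk⟩ := Finset.mem_sigma.mp hq
        rw [Finset.mem_Ioo] at hm
        obtain ⟨h1, h2, h3⟩ := (mem_cutRows hm.2.le).mp hk
        simp only at h1 h2 h3 hm
        refine (mem_cutRows hs).mpr ⟨Function.update_self _ _ _, fun b hb => ?_, fun b hb => ?_⟩
        · rw [List.mem_cons, not_or] at hb
          rw [Function.update_of_ne hb.1]
          exact h2 b hb.2
        · rw [Function.update_of_ne (hne b hb)]
          rcases List.mem_cons.mp hb with rfl | hb
          · dsimp only
            rw [hchain.1, Function.update_self, h1]
            exact ⟨fun h => absurd h hjl, fun _ => hm⟩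
          · rw [Function.update_of_ne (hpr b hb)]
            exact h3 b hb
      · intro k hk
        obtain ⟨h1, -, -⟩ := (mem_cutRows hs).mp hk
        simp [← h1]
      · rintro ⟨m, k⟩ hq
        obtain ⟨hm, hk⟩ := Finset.mem_sigma.mp hq
        rw [Finset.mem_Ioo] at hm
        obtain ⟨h1, h2, -⟩ := (mem_cutRows hm.2.le).mp hk
        simp only at h1 h2 hm
        have h0 : k p = 0 := h2 p hp
        simp [Function.update_of_ne hpj.symm, h1, ← h0]
      · intro k hk
        obtain ⟨h1, -, -⟩ := (mem_cutRows hs).mp hk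
        rw [List.map_cons, List.prod_cons]
        congr 1
        · rw [pieceCoeff, if_neg hjl, hchain.1, h1]
        · congr 1
          refine List.map_congr_left fun b hb => ?_
          simp only [pieceCoeff]
          rw [Function.update_of_ne (hne b (List.mem_cons_of_mem _ hb)),
            Function.update_of_ne (hpr b hb)]

end CutPoints

/-! ### Configurations and pair traces -/

section Configurations

variable {n d : ℕ}

theorem val_sub_eq (k x : Fin n) :
    (x - k).val = if k ≤ x then x.val - k.val else n + x.val - k.val := by
  split_ifs with h
  · exact Fin.sub_val_of_le h
  · exact Fin.coe_sub_iff_lt.mpr (not_le.mp h)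

theorem mem_arc_of_lt {k l : Fin n} (h : k < l) (x : Fin n) :
    (x ∈ arc k l ↔ k ≤ x ∧ x ≤ l) ∧ (x ∈ arc l k ↔ l ≤ x ∨ x ≤ k) := by
  simp only [arc, Set.mem_ofPred_eq, val_sub_eq]
  constructor <;> split_ifs <;> omega

/-- Configurations are the noncrossing sets of pairs, in terms of the linear order. -/
theorem isConfiguration_iff (K : Finset (Sym2 (Fin n))) : IsConfiguration K ↔
    (∀ a, s(a, a) ∉ K) ∧
      ∀ a c b e : Fin n, a < c → c < b → b < e → s(a, b) ∈ K → s(c, e) ∉ K := by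
  constructor
  · rintro ⟨h1, h2⟩
    refine ⟨fun a ha => h1 _ ha rfl, fun a c b e hac hcb hbe hab hce => ?_⟩
    have h := h2 c e a b hce hab
    rw [(mem_arc_of_lt (hac.trans hcb) c).1, (mem_arc_of_lt (hac.trans hcb) c).2,
      (mem_arc_of_lt (hac.trans hcb) e).1, (mem_arc_of_lt (hac.trans hcb) e).2] at h
    omega
  · rintro ⟨h1, h2⟩
    refine ⟨fun e he => ?_, ?_⟩
    · induction e using Sym2.ind with
      | _ a b =>
        rw [Sym2.mk_isDiag_iff]
        rintro rfl
        exact h1 a he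
    -- it suffices to treat pairs `{i, j}` and `{k, l}` with `i < j` and `k < l`
    · have key : ∀ i j k l : Fin n, i < j → k < l → s(i, j) ∈ K → s(k, l) ∈ K →
          (i ∈ arc k l ∧ j ∈ arc k l) ∨ (i ∈ arc l k ∧ j ∈ arc l k) := by
        intro i j k l hij hkl h3 h4
        have h5 : ¬ (i < k ∧ k < j ∧ j < l) := fun h => h2 i k j l h.1 h.2.1 h.2.2 h3 h4
        have h6 : ¬ (k < i ∧ i < l ∧ l < j) := fun h => h2 k i l j h.1 h.2.1 h.2.2 h4 h3
        rw [(mem_arc_of_lt hkl i).1, (mem_arc_of_lt hkl i).2, (mem_arc_of_lt hkl j).1,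
          (mem_arc_of_lt hkl j).2]
        omega
      intro i j k l h3 h4
      rcases lt_trichotomy i j with hij | rfl | hij
      · rcases lt_trichotomy k l with hkl | rfl | hkl
        · exact key i j k l hij hkl h3 h4
        · exact absurd h4 (h1 k)
        · exact (key i j l k hij hkl h3 (Sym2.eq_swap ▸ h4)).symm
      · exact absurd h3 (h1 i)
      · rcases lt_trichotomy k l with hkl | rfl | hkl
        · exact (key j i k l hij hkl (Sym2.eq_swap ▸ h3) h4).imp And.symm And.symm
        · exact absurd h4 (h1 k)
        · exact (key j i l k hij hkl (Sym2.eq_swap ▸ h3) (Sym2.eq_swap ▸ h4)).symm.imp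
            And.symm And.symm

theorem reverse_map_add_eq (i : Fin n) :
    ((List.finRange n).map fun t => i + t).reverse = nbrOrder i ++ [i] := by
  rw [List.reverse_eq_iff, List.reverse_append, List.reverse_singleton, List.singleton_append]
  rcases n with _ | n
  · exact i.elim0
  have hirr : Std.Irrefl fun a b : Fin (n + 1) => (a - i).val < (b - i).val :=
    ⟨fun a => lt_irrefl _⟩
  have hanti : Std.Antisymm fun a b : Fin (n + 1) => (a - i).val < (b - i).val :=
    ⟨fun a b h h' => absurd h h'.not_gt⟩
  refine List.Pairwise.eq_of_mem_iff (r := fun a b : Fin (n + 1) => (a - i).val < (b - i).val)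
    ?_ ?_ ?_
  · rw [List.pairwise_map]
    refine (List.pairwise_lt_finRange _).imp fun {a b} h => ?_
    rw [add_sub_cancel_left, add_sub_cancel_left]
    exact h
  · rw [List.pairwise_cons]
    refine ⟨fun b hb => ?_, ?_⟩
    · have := mem_nbrOrder.mp (List.mem_reverse.mp hb)
      simp only [val_sub_eq]
      split_ifs <;> omega
    · rw [List.pairwise_reverse, nbrOrder, List.pairwise_append]
      refine ⟨?_, ?_, ?_⟩
      · refine (pairwise_descending _).imp_of_mem fun {a b} ha hb hab => ?_
        rw [mem_descending] at ha hb
        simp only [val_sub_eq]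
        split_ifs <;> omega
      · refine (pairwise_descending _).imp_of_mem fun {a b} ha hb hab => ?_
        rw [mem_descending] at ha hb
        simp only [val_sub_eq]
        split_ifs <;> omega
      · intro a ha b hb
        rw [mem_descending] at ha hb
        simp only [val_sub_eq]
        split_ifs <;> omega
  · intro b
    simp only [List.mem_map, List.mem_finRange, true_and, List.mem_cons, List.mem_reverse,
      mem_nbrOrder]
    exact ⟨fun _ => (em _), fun _ => ⟨b - i, add_sub_cancel i b⟩⟩

/-- The neighbours of `i` in `K`, in the order in which the pieces of the `i`-th word are linked
to them. -/
def nbrs (K : Finset (Sym2 (Fin n))) (i : Fin n) : List (Fin n) :=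
  (nbrOrder i).filter fun j => s(i, j) ∈ K

theorem nodup_nbrOrder (i : Fin n) : (nbrOrder i).Nodup := by
  have h := List.nodup_reverse.mpr ((List.nodup_finRange n).map
    (f := fun t => i + t) ?_)
  · rw [reverse_map_add_eq] at h
    exact h.of_append_left
  · rcases n with _ | n
    · exact i.elim0
    · exact add_right_injective i

theorem nodup_cons_nbrs (K : Finset (Sym2 (Fin n))) (i : Fin n) : (i :: nbrs K i).Nodup := by
  rw [List.nodup_cons]
  refine ⟨fun h => ?_, (nodup_nbrOrder i).filter _⟩
  exact mem_nbrOrder.mp (List.mem_filter.mp h).1 rfl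

theorem circ_eq (K : Finset (Sym2 (Fin n))) (i : Fin n) : circ K i = nbrs K i ++ [i] := by
  rw [circ, ← List.filter_reverse, reverse_map_add_eq, List.filter_append, nbrs]
  congr 1
  · refine List.filter_congr fun b hb => ?_
    have := mem_nbrOrder.mp hb
    simp [this]
  · simp

theorem mem_nbrs {K : Finset (Sym2 (Fin n))} (hK : IsConfiguration K) {i j : Fin n} :
    j ∈ nbrs K i ↔ s(i, j) ∈ K := by
  simp only [nbrs, List.mem_filter, mem_nbrOrder, decide_eq_true_eq, and_iff_right_iff_imp]
  rintro h rfl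
  exact ((isConfiguration_iff K).mp hK).1 j h

theorem mem_circ {K : Finset (Sym2 (Fin n))} {i j : Fin n} :
    j ∈ circ K i ↔ j ∈ i :: nbrs K i := by
  simp [circ_eq, or_comm]

theorem nodup_circ (K : Finset (Sym2 (Fin n))) (i : Fin n) : (circ K i).Nodup := by
  rw [circ_eq]
  exact (List.perm_append_singleton i _).nodup_iff.mpr (nodup_cons_nbrs K i)

theorem circPred_getElem (K : Finset (Sym2 (Fin n))) (i : Fin n) (t : ℕ)
    (ht : t < (circ K i).length) : circPred K i (circ K i)[t] =
      (circ K i)[(t + ((circ K i).length - 1)) % (circ K i).length]'(Nat.mod_lt _ (by omega)) := by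
  rw [circPred, dif_pos (List.getElem_mem ht), List.prev_getElem _ (nodup_circ K i)]

theorem isChain_nbrs (K : Finset (Sym2 (Fin n))) (i : Fin n) :
    (i :: nbrs K i).IsChain fun a b => circPred K i b = a := by
  rw [List.isChain_iff_getElem]
  intro t ht
  have hlen : (circ K i).length = (nbrs K i).length + 1 := by simp [circ_eq]
  rw [List.length_cons] at ht
  have h := circPred_getElem K i t (by omega)
  have h1 : (circ K i)[t]'(by omega) = (nbrs K i)[t]'(by omega) := by
    simp only [circ_eq]
    exact List.getElem_append_left (by omega)
  rw [h1] at h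
  rw [List.getElem_cons_succ, h]
  rcases t with _ | t
  · rw [List.getElem_cons_zero]
    simp only [circ_eq, List.length_append, List.length_singleton, Nat.zero_add,
      Nat.add_sub_cancel, Nat.mod_eq_of_lt (Nat.lt_succ_self _)]
    simp
  · have e : (t + 1 + ((circ K i).length - 1)) % (circ K i).length = t := by
      rw [show t + 1 + ((circ K i).length - 1) = t + (circ K i).length by omega,
        Nat.add_mod_right, Nat.mod_eq_of_lt (by omega)]
    simp only [e, List.getElem_cons_succ]
    simp only [circ_eq]
    exact List.getElem_append_left (by omega)

theorem getLast?_nbrs (K : Finset (Sym2 (Fin n))) (i : Fin n) (h : nbrs K i ≠ []) :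
    (nbrs K i).getLast? = some (circPred K i i) := by
  have hlen : (circ K i).length = (nbrs K i).length + 1 := by simp [circ_eq]
  have hpos : 0 < (nbrs K i).length := List.length_pos_iff.mpr h
  have h1 := circPred_getElem K i (nbrs K i).length (by omega)
  have h2 : (circ K i)[(nbrs K i).length]'(by omega) = i := by
    simp only [circ_eq]
    simp
  have e : ((nbrs K i).length + ((circ K i).length - 1)) % (circ K i).length =
      (nbrs K i).length - 1 := by
    rw [show (nbrs K i).length + ((circ K i).length - 1) =
      (nbrs K i).length - 1 + (circ K i).length by omega, Nat.add_mod_right,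
      Nat.mod_eq_of_lt (by omega)]
  rw [h2] at h1
  simp only [e] at h1
  rw [h1, List.getLast?_eq_getElem?, List.getElem?_eq_getElem (by omega)]
  congr 1
  simp only [circ_eq]
  exact (List.getElem_append_left (by omega)).symm

theorem mem_isolated {K : Finset (Sym2 (Fin n))} (hK : IsConfiguration K) {i : Fin n} :
    i ∈ isolated K ↔ nbrs K i = [] := by
  simp [isolated, List.eq_nil_iff_forall_not_mem, mem_nbrs hK]

theorem circPred_self_mem {K : Finset (Sym2 (Fin n))} {i : Fin n} (h : nbrs K i ≠ []) :
    circPred K i i ∈ nbrs K i := List.mem_of_getLast? (getLast?_nbrs K i h)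

/-- The conditions on a system of cut points, word by word. -/
theorem isCutSystem_iff {K : Finset (Sym2 (Fin n))} (hK : IsConfiguration K)
    (A : Fin n → List (Fin d)) (k : Fin n → Fin n → ℕ) : IsCutSystem A K k ↔
      ∀ i, IsCutRow (A i).length (circPred K i) (circPred K i i) i 0 (nbrs K i) (k i) := by
  have hne : ∀ i, ∀ j ∈ nbrs K i, j ≠ i := fun i j hj h =>
    (List.nodup_cons.mp (nodup_cons_nbrs K i)).1 (h ▸ hj)
  constructor
  · intro h i
    refine ⟨h.self i, fun j hj => h.unused i j (by rwa [mem_circ]), fun j hj => ⟨?_, ?_⟩⟩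
    · rintro rfl
      exact h.last i fun hi => by
        rw [(mem_isolated hK).mp hi] at hj
        simp at hj
    · intro hjl
      refine h.chain i j ?_
      simp [circStarStar, mem_circ, hj, hjl, hne i j hj]
  · intro h
    refine ⟨fun i => (h i).1, fun i hi => ?_, fun i j hj => ?_, fun i j hj => ?_⟩
    · rw [mem_isolated hK] at hi
      exact ((h i).2.2 _ (circPred_self_mem hi)).1 rfl
    · simp only [circStarStar, List.mem_filter, mem_circ, decide_eq_true_eq] at hj
      exact ((h i).2.2 j ((List.mem_cons.mp hj.1).resolve_left hj.2.1)).2 hj.2.2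
    · exact (h i).2.1 j (by rwa [mem_circ] at hj)

theorem cutSystems_eq {K : Finset (Sym2 (Fin n))} (hK : IsConfiguration K)
    (A : Fin n → List (Fin d)) : cutSystems A K = Fintype.piFinset fun i =>
      cutRows (A i).length (circPred K i) (circPred K i i) i 0 (nbrs K i) := by
  ext k
  rw [mem_cutSystems, isCutSystem_iff hK, Fintype.mem_piFinset]
  exact forall_congr' fun i => (mem_cutRows (Nat.zero_le _)).symm

/-- The trace of a pair as a sum over the word of links between its two ends. -/
theorem pairTrace_eq (A : Fin n → List (Fin d)) (κ : Sym2 (Fin n) → ℝ)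
    (K : Finset (Sym2 (Fin n))) (k : Fin n → Fin n → ℕ) (N : ℕ) (hN : ∀ a, (A a).length ≤ N)
    (i j : Fin n) :
    pairTrace A κ K k i j =
      ∑ w ∈ (wordsUpTo d N).filter (· ≠ []), ((κ s(i, j) : ℝ) : ℂ) ^ w.length *
        (pieceCoeff (A i) (circPred K i) (circPred K i i) (k i) j w.reverse *
          pieceCoeff (A j) (circPred K j) (circPred K j j) (k j) i w) := by
  have hleft : ∀ w, inner ℂ (vacuum d)
      (evalFock (pieceIoo (A i) (k i (circPred K i j)) (k i j))
        (atLetter leftAnnihilation (A i) (k i j) (ket w))) =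
      stripLetter (A i) (k i j)
        (wickCoeff (pieceIoo (A i) (k i (circPred K i j)) (k i j))) w.reverse := by
    intro w
    unfold atLetter stripLetter
    split_ifs
    · rw [inner_vacuum_evalFock_leftAnnihilation_ket]
    · simp
  have hright : ∀ w, inner ℂ (ket w) (atLetter rightCreation (A j) (k j i)
      (evalFock (pieceIoo (A j) (k j (circPred K j i)) (k j i)) (vacuum d))) =
      stripLetter (A j) (k j i)
        (wickCoeff (pieceIoo (A j) (k j (circPred K j i)) (k j i))) w := by
    intro w
    unfold atLetter stripLetter
    split_ifs
    · rw [inner_ket_rightCreation_evalFock]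
    · simp
  have hlen₁ : ∀ w : List (Fin d), N < w.length →
      wickCoeff (pieceIoc (A j) (k j (circPred K j i)) (k j i)) w = 0 := by
    intro w hw
    by_contra h
    have h1 := length_le_of_wickCoeff_ne_zero h
    have h2 := hN j
    simp only [pieceIoc, List.length_drop, List.length_take] at h1
    omega
  have hlen₂ : ∀ w : List (Fin d), N < w.length → stripLetter (A j) (k j i)
      (wickCoeff (pieceIoo (A j) (k j (circPred K j i)) (k j i))) w = 0 := by
    intro w hw
    unfold stripLetter
    split_ifs with hb
    · rcases List.eq_nil_or_concat w with rfl | ⟨w, y, rfl⟩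
      · rfl
      · rw [List.concat_eq_append, stripLast_concat]
        split_ifs
        · by_contra h
          have h1 := length_le_of_wickCoeff_ne_zero h
          have h2 := hN j
          simp only [pieceIoo, List.length_drop, List.length_take] at h1
          simp only [List.concat_eq_append, List.length_append, List.length_singleton] at hw
          omega
        · rfl
    · rfl
  unfold pairTrace pieceCoeff vacuumState
  split_ifs
  · rw [inner_vacuum_Delta _ _ N _ fun w hw => by rw [inner_ket_evalFock_vacuum, hlen₁ w hw]]
    simp only [inner_vacuum_evalFock_ket, inner_ket_evalFock_vacuum]
  · rw [inner_vacuum_Delta _ _ N _ fun w hw => by rw [hright, hlen₂ w hw]]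
    simp only [inner_vacuum_evalFock_ket, hright]
  · beta_reduce
    rw [← mul_apply_eq_comp (evalFock _) (atLetter _ _ _),
      inner_vacuum_Delta _ _ N _ fun w hw => by rw [inner_ket_evalFock_vacuum, hlen₁ w hw]]
    simp only [mul_apply_eq_comp, hleft, inner_ket_evalFock_vacuum]
  · beta_reduce
    rw [← mul_apply_eq_comp (evalFock _) (atLetter _ _ _),
      inner_vacuum_Delta _ _ N _ fun w hw => by rw [hright, hlen₂ w hw]]
    simp only [mul_apply_eq_comp, hleft, hright]

end Configurations

/-! ### Summation over configurations -/

section Expansion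

variable {n d : ℕ}

theorem mem_configurations {K : Finset (Sym2 (Fin n))} :
    K ∈ configurations n ↔ IsConfiguration K := by
  simp [configurations]

open Classical in
/-- The configuration of the pairs of words that are linked. -/
noncomputable def linkSupport (ω : Fin n → Fin n → List (Fin d)) : Finset (Sym2 (Fin n)) :=
  Finset.univ.filter fun e => ∃ a b, e = s(a, b) ∧ ω a b ≠ []

theorem mem_linkSupport {ω : Fin n → Fin n → List (Fin d)} (hω : IsLabelling ω) {a b : Fin n} :
    s(a, b) ∈ linkSupport ω ↔ ω a b ≠ [] := by
  simp only [linkSupport, Finset.mem_filter, Finset.mem_univ, true_and]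
  constructor
  · rintro ⟨a', b', h, h'⟩
    rcases Sym2.eq_iff.mp h with ⟨rfl, rfl⟩ | ⟨rfl, rfl⟩
    · exact h'
    · exact hω.ne_nil_symm h'
  · exact fun h => ⟨a, b, rfl, h⟩

theorem isConfiguration_linkSupport {ω : Fin n → Fin n → List (Fin d)} (hω : IsLabelling ω) :
    IsConfiguration (linkSupport ω) := by
  rw [isConfiguration_iff]
  refine ⟨fun a ha => (mem_linkSupport hω).mp ha (hω.diag a), fun a c b e h1 h2 h3 hab hce => ?_⟩
  exact (mem_linkSupport hω).mp hce
    (hω.noncrossing a c b e h1 h2 h3 ((mem_linkSupport hω).mp hab))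

theorem flatten_map_filter {l : List (Fin n)} {f : Fin n → List (Fin d)} {p : Fin n → Prop}
    [DecidablePred p] (h : ∀ b, ¬ p b → f b = []) :
    ((l.filter fun b => p b).map f).flatten = (l.map f).flatten := by
  induction l with
  | nil => rfl
  | cons b l ih =>
    by_cases hb : p b
    · simp [hb, ih]
    · simp [hb, ih, h b hb]

/-- The Wick coefficient of one word, as a sum over its cut points. -/
theorem wickCoeff_blockWord {ω : Fin n → Fin n → List (Fin d)} (hω : IsLabelling ω)
    (A : List (Fin d)) (i : Fin n) : wickCoeff A (blockWord ω i) =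
      ∑ k ∈ cutRows A.length (circPred (linkSupport ω) i) (circPred (linkSupport ω) i i) i 0
          (nbrs (linkSupport ω) i),
        (if i ∈ isolated (linkSupport ω) then wickCoeff A [] else 1) *
          ((nbrs (linkSupport ω) i).map fun j =>
            pieceCoeff A (circPred (linkSupport ω) i) (circPred (linkSupport ω) i i) k j
              (ω i j)).prod := by
  set K := linkSupport ω with hKdef
  have hK : IsConfiguration K := isConfiguration_linkSupport hω
  have hbw : blockWord ω i = ((nbrs K i).map (ω i)).flatten := by
    rw [nbrs, flatten_map_filter, blockWord]
    intro b hb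
    rw [hKdef, mem_linkSupport hω, not_not] at hb
    exact hb
  rw [hbw]
  by_cases hi : nbrs K i = []
  · rw [if_pos ((mem_isolated hK).mpr hi), hi, Finset.sum_eq_single 0]
    · simp
    · intro k hk hne
      obtain ⟨h1, h2, -⟩ := (mem_cutRows (Nat.zero_le _)).mp hk
      refine absurd (funext fun j => ?_) hne
      by_cases hj : j = i
      · rw [hj, h1]
        rfl
      · exact h2 j (by simpa using hj)
    · intro h
      exact absurd ((mem_cutRows (Nat.zero_le _)).mpr ⟨rfl, fun _ _ => rfl, by simp⟩) h
  · rw [if_neg fun h => hi ((mem_isolated hK).mp h)]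
    simp only [one_mul]
    rw [sum_cutRows A (ω i) (circPred K i) (circPred K i i) (nbrs K i) i 0 (nodup_cons_nbrs K i)
      (isChain_nbrs K i) (getLast?_nbrs K i hi) (Nat.zero_le _), List.drop_zero]
    intro j hj
    rwa [mem_nbrs hK, hKdef, mem_linkSupport hω] at hj

/-- Every unordered pair has two orientations. -/
theorem prod_nbrs {K : Finset (Sym2 (Fin n))} (hK : IsConfiguration K)
    {σ : Sym2 (Fin n) → Fin n × Fin n} (hσ : ∀ e, s((σ e).1, (σ e).2) = e)
    (g : Fin n → Fin n → ℂ) : ∏ i, ((nbrs K i).map (g i)).prod =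
      ∏ e ∈ K, g (σ e).1 (σ e).2 * g (σ e).2 (σ e).1 := by
  have h1 : ∀ i, ((nbrs K i).map (g i)).prod = ∏ j, if s(i, j) ∈ K then g i j else 1 := by
    intro i
    rw [← List.prod_toFinset _ (List.nodup_cons.mp (nodup_cons_nbrs K i)).2,
      ← Finset.prod_filter]
    congr 1
    ext j
    simp [mem_nbrs hK]
  simp only [h1]
  rw [← Fintype.prod_prod_type' fun i j => if s(i, j) ∈ K then g i j else 1,
    ← Finset.prod_filter (fun p : Fin n × Fin n => s(p.1, p.2) ∈ K) fun p => g p.1 p.2,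
    ← Finset.prod_fiberwise_of_maps_to (t := K) (g := fun p : Fin n × Fin n => s(p.1, p.2))
      fun p hp => (Finset.mem_filter.mp hp).2]
  refine Finset.prod_congr rfl fun e he => ?_
  have hne : (σ e).1 ≠ (σ e).2 := by
    intro h
    have h2 := hσ e
    rw [h] at h2
    exact ((isConfiguration_iff K).mp hK).1 _ (h2 ▸ he)
  have hset : (Finset.univ.filter fun p : Fin n × Fin n => s(p.1, p.2) ∈ K).filter
      (fun p => s(p.1, p.2) = e) = {((σ e).1, (σ e).2), ((σ e).2, (σ e).1)} := by
    ext ⟨a, b⟩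
    simp only [Finset.mem_filter, Finset.mem_univ, true_and, Finset.mem_insert,
      Finset.mem_singleton, Prod.mk.injEq]
    rw [← Sym2.eq_iff, hσ e]
    exact ⟨fun h => h.2, fun h => ⟨h ▸ he, h⟩⟩
  rw [hset, Finset.prod_pair fun h => hne (congr_arg Prod.fst h)]

theorem length_orientation {ω : Fin n → Fin n → List (Fin d)} (hω : IsLabelling ω)
    {σ : Sym2 (Fin n) → Fin n × Fin n} (hσ : ∀ e, s((σ e).1, (σ e).2) = e) (a b : Fin n) :
    (ω (σ s(a, b)).2 (σ s(a, b)).1).length = (ω a b).length := by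
  rcases Sym2.eq_iff.mp (hσ s(a, b)) with ⟨h1, h2⟩ | ⟨h1, h2⟩
  · rw [h1, h2, hω.symm a b, List.length_reverse]
  · rw [h1, h2]

theorem edgeWeight_eq_prod_linkSupport {ω : Fin n → Fin n → List (Fin d)} (hω : IsLabelling ω)
    {σ : Sym2 (Fin n) → Fin n × Fin n} (hσ : ∀ e, s((σ e).1, (σ e).2) = e)
    (κ : Sym2 (Fin n) → ℝ) : edgeWeight κ ω =
      ∏ e ∈ linkSupport ω, ((κ e : ℝ) : ℂ) ^ (ω (σ e).2 (σ e).1).length := by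
  rw [edgeWeight, ← Finset.prod_filter_mul_prod_filter_not
    (Finset.univ.filter fun p : Fin n × Fin n => p.1 < p.2) (fun p => ω p.1 p.2 ≠ []),
    Finset.prod_eq_one (s := (Finset.univ.filter fun p : Fin n × Fin n =>
      p.1 < p.2).filter fun p => ¬ ω p.1 p.2 ≠ []), mul_one]
  · refine Finset.prod_bij (fun p _ => s(p.1, p.2)) ?_ ?_ ?_ ?_
    · intro p hp
      exact (mem_linkSupport hω).mpr (Finset.mem_filter.mp hp).2
    · rintro ⟨a, b⟩ hp ⟨a', b'⟩ hp' h
      simp only [Finset.mem_filter, Finset.mem_univ, true_and] at hp hp'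
      rcases Sym2.eq_iff.mp h with ⟨rfl, rfl⟩ | ⟨rfl, rfl⟩
      · rfl
      · exact absurd hp.1 hp'.1.not_gt
    · intro e he
      induction e using Sym2.ind with
      | _ a b =>
        have hab := (mem_linkSupport hω).mp he
        rcases lt_trichotomy a b with h | rfl | h
        · exact ⟨(a, b), by simp [h, hab], rfl⟩
        · exact absurd (hω.diag a) hab
        · exact ⟨(b, a), by simp [h, hω.ne_nil_symm hab], Sym2.eq_swap⟩
    · intro p _
      rw [length_orientation hω hσ]
  · intro p hp
    have := (Finset.mem_filter.mp hp).2
    rw [not_not] at this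
    rw [this, List.length_nil, pow_zero]

/-- The labelling with `ω b a = v {a, b}` if `(a, b)` is the chosen orientation of `{a, b}`. -/
def orientedLabelling (σ : Sym2 (Fin n) → Fin n × Fin n) (v : Sym2 (Fin n) → List (Fin d)) :
    Fin n → Fin n → List (Fin d) := fun a b =>
  if σ s(a, b) = (b, a) then v s(a, b) else (v s(a, b)).reverse

theorem orientedLabelling_ne_nil {σ : Sym2 (Fin n) → Fin n × Fin n}
    {v : Sym2 (Fin n) → List (Fin d)} {a b : Fin n} :
    orientedLabelling σ v a b ≠ [] ↔ v s(a, b) ≠ [] := by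
  unfold orientedLabelling
  split_ifs <;> simp

theorem isLabelling_orientedLabelling {K : Finset (Sym2 (Fin n))} (hK : IsConfiguration K)
    {σ : Sym2 (Fin n) → Fin n × Fin n} (hσ : ∀ e, s((σ e).1, (σ e).2) = e)
    {v : Sym2 (Fin n) → List (Fin d)} (hv : ∀ e, v e ≠ [] ↔ e ∈ K) :
    IsLabelling (orientedLabelling σ v) := by
  obtain ⟨h1, h2⟩ := (isConfiguration_iff K).mp hK
  have hdiag : ∀ a, v s(a, a) = [] := fun a => by
    by_contra h
    exact h1 a ((hv _).mp h)
  refine ⟨fun a b => ?_, fun a => ?_, fun a c b e hac hcb hbe hab => ?_⟩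
  · by_cases hab : a = b
    · subst hab
      simp [orientedLabelling, hdiag]
    · unfold orientedLabelling
      rw [Sym2.eq_swap (a := b) (b := a)]
      rcases Sym2.eq_iff.mp (hσ s(a, b)) with ⟨e1, e2⟩ | ⟨e1, e2⟩
      · have e : σ s(a, b) = (a, b) := Prod.ext e1 e2
        rw [e, if_pos rfl, if_neg (by simp [hab]), List.reverse_reverse]
      · have e : σ s(a, b) = (b, a) := Prod.ext e1 e2
        rw [e, if_pos rfl, if_neg (by simp [Ne.symm hab])]
  · by_contra h
    exact orientedLabelling_ne_nil.mp h (hdiag a)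
  · by_contra h
    exact h2 a c b e hac hcb hbe ((hv _).mp (orientedLabelling_ne_nil.mp hab))
      ((hv _).mp (orientedLabelling_ne_nil.mp h))

theorem orientedLabelling_apply {σ : Sym2 (Fin n) → Fin n × Fin n}
    (hσ : ∀ e, s((σ e).1, (σ e).2) = e) (v : Sym2 (Fin n) → List (Fin d)) (e : Sym2 (Fin n)) :
    orientedLabelling σ v (σ e).2 (σ e).1 = v e := by
  unfold orientedLabelling
  rw [Sym2.eq_swap, hσ e, if_pos rfl]

theorem orientedLabelling_eq {ω : Fin n → Fin n → List (Fin d)} (hω : IsLabelling ω)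
    {σ : Sym2 (Fin n) → Fin n × Fin n} (hσ : ∀ e, s((σ e).1, (σ e).2) = e) :
    orientedLabelling σ (fun e => ω (σ e).2 (σ e).1) = ω := by
  funext a b
  unfold orientedLabelling
  beta_reduce
  split_ifs with h
  · rw [h]
  · rcases Sym2.eq_iff.mp (hσ s(a, b)) with ⟨e1, e2⟩ | ⟨e1, e2⟩
    · rw [e1, e2, ← hω.symm]
    · exact absurd (Prod.ext e1 e2) h

/-- The labellings with a given support are the independent choices of a nonempty word for each
pair. -/
theorem sum_labellings_support (N : ℕ) {K : Finset (Sym2 (Fin n))} (hK : IsConfiguration K)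
    {σ : Sym2 (Fin n) → Fin n × Fin n} (hσ : ∀ e, s((σ e).1, (σ e).2) = e)
    (h : Sym2 (Fin n) → List (Fin d) → ℂ) :
    ∑ ω ∈ (labellings n d N).filter (fun ω => linkSupport ω = K),
        ∏ e ∈ K, h e (ω (σ e).2 (σ e).1) =
      ∏ e ∈ K, ∑ w ∈ (wordsUpTo d N).filter (· ≠ []), h e w := by
  have hite (F : Sym2 (Fin n) → ℂ) : ∏ e ∈ K, F e = ∏ e, if e ∈ K then F e else 1 := by
    rw [Finset.prod_ite_mem, Finset.univ_inter]
  have hsum : ∀ e, (if e ∈ K then ∑ w ∈ (wordsUpTo d N).filter (· ≠ []), h e w else 1) =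
      ∑ w ∈ if e ∈ K then (wordsUpTo d N).filter (· ≠ []) else {[]},
        if e ∈ K then h e w else 1 := by
    intro e
    split_ifs <;> simp
  rw [hite fun e => ∑ w ∈ (wordsUpTo d N).filter (· ≠ []), h e w, Finset.prod_congr rfl
    fun e _ => hsum e, Finset.prod_univ_sum]
  refine Finset.sum_nbij' (fun ω e => ω (σ e).2 (σ e).1) (orientedLabelling σ) ?_ ?_ ?_ ?_ ?_
  · intro ω hω
    obtain ⟨hω, hsupp⟩ := Finset.mem_filter.mp hω
    rw [mem_labellings] at hω
    refine Fintype.mem_piFinset.mpr fun e => ?_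
    have he : e ∈ K ↔ ω (σ e).2 (σ e).1 ≠ [] := by
      rw [← mem_linkSupport hω.2, Sym2.eq_swap, hσ e, hsupp]
    split_ifs with h1
    · exact Finset.mem_filter.mpr ⟨mem_wordsUpTo.mpr (hω.1 _ _), he.mp h1⟩
    · rw [he, not_not] at h1
      rw [h1, Finset.mem_singleton]
  · intro v hv
    rw [Fintype.mem_piFinset] at hv
    have hvK : ∀ e, v e ≠ [] ↔ e ∈ K := by
      intro e
      have := hv e
      split_ifs at this with h1
      · exact ⟨fun _ => h1, fun _ => (Finset.mem_filter.mp this).2⟩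
      · rw [Finset.mem_singleton] at this
        simp [this, h1]
    have hlab := isLabelling_orientedLabelling hK hσ hvK
    refine Finset.mem_filter.mpr ⟨mem_labellings.mpr ⟨fun a b => ?_, hlab⟩, ?_⟩
    · have hlen : (v s(a, b)).length ≤ N := by
        have := hv s(a, b)
        split_ifs at this
        · exact mem_wordsUpTo.mp (Finset.mem_filter.mp this).1
        · rw [Finset.mem_singleton.mp this]
          exact Nat.zero_le _
      unfold orientedLabelling
      split_ifs
      · exact hlen
      · rwa [List.length_reverse]
    · ext e
      induction e using Sym2.ind with
      | _ a b => rw [mem_linkSupport hlab, orientedLabelling_ne_nil, hvK]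
  · intro ω hω
    exact orientedLabelling_eq (mem_labellings.mp (Finset.mem_filter.mp hω).1).2 hσ
  · intro v _
    exact funext fun e => orientedLabelling_apply hσ v e
  · intro ω _
    exact hite _

/-- The sum over labellings, arranged by configurations and cut points. -/
theorem linkSum_eq_sum_configurations (N : ℕ) (κ : Sym2 (Fin n) → ℝ)
    (A : Fin n → List (Fin d)) (hN : ∀ a, (A a).length ≤ N)
    {σ : Sym2 (Fin n) → Fin n × Fin n} (hσ : ∀ e, s((σ e).1, (σ e).2) = e) :
    linkSum N κ A = ∑ K ∈ configurations n, ∑ k ∈ cutSystems A K,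
      (∏ i ∈ isolated K, vacuumState (evalFock (A i))) *
        ∏ e ∈ K, pairTrace A κ K k (σ e).1 (σ e).2 := by
  rw [linkSum, ← Finset.sum_fiberwise_of_maps_to (t := configurations n) (g := linkSupport)]
  swap
  · intro ω hω
    exact mem_configurations.mpr (isConfiguration_linkSupport (mem_labellings.mp hω).2)
  refine Finset.sum_congr rfl fun K hK => ?_
  rw [mem_configurations] at hK
  -- the contribution of the pair `e`, when the links read at the second end spell `w`
  let h (k : Fin n → Fin n → ℕ) (e : Sym2 (Fin n)) (w : List (Fin d)) : ℂ :=
    ((κ e : ℝ) : ℂ) ^ w.length *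
      (pieceCoeff (A (σ e).1) (circPred K (σ e).1) (circPred K (σ e).1 (σ e).1) (k (σ e).1)
          (σ e).2 w.reverse *
        pieceCoeff (A (σ e).2) (circPred K (σ e).2) (circPred K (σ e).2 (σ e).2) (k (σ e).2)
          (σ e).1 w)
  have hω : ∀ ω ∈ (labellings n d N).filter (fun ω => linkSupport ω = K),
      edgeWeight κ ω * ∏ i, wickCoeff (A i) (blockWord ω i) =
        ∑ k ∈ cutSystems A K, (∏ i ∈ isolated K, vacuumState (evalFock (A i))) *
          ∏ e ∈ K, h k e (ω (σ e).2 (σ e).1) := by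
    intro ω hω
    obtain ⟨hmem, rfl⟩ := Finset.mem_filter.mp hω
    replace hω := (mem_labellings.mp hmem).2
    rw [edgeWeight_eq_prod_linkSupport hω hσ, Finset.prod_congr rfl
      fun i _ => wickCoeff_blockWord hω (A i) i, Finset.prod_univ_sum, ← cutSystems_eq hK,
      Finset.mul_sum]
    refine Finset.sum_congr rfl fun k _ => ?_
    rw [Finset.prod_mul_distrib, Finset.prod_ite_mem, Finset.univ_inter, prod_nbrs hK hσ
      fun i j => pieceCoeff (A i) (circPred (linkSupport ω) i) (circPred (linkSupport ω) i i)
        (k i) j (ω i j), mul_left_comm, ← Finset.prod_mul_distrib]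
    congr 1
    · exact Finset.prod_congr rfl fun i _ => (vacuumState_evalFock _).symm
    · refine Finset.prod_congr rfl fun e _ => ?_
      simp only [h]
      rw [hω.symm (σ e).2 (σ e).1]
  rw [Finset.sum_congr rfl hω, Finset.sum_comm]
  refine Finset.sum_congr rfl fun k _ => ?_
  rw [← Finset.mul_sum, sum_labellings_support N hK hσ]
  congr 1
  refine Finset.prod_congr rfl fun e _ => ?_
  rw [pairTrace_eq A κ K k N hN, hσ e]

end Expansion

end CircleConfig

open CircleConfig
theorem proposition3p3 {𝒜 : Type*} [CStarAlgebra 𝒜] (τ : 𝒜 →ₗ[ℂ] ℂ)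
    (hτ : IsCStarProbabilitySpace τ) (n d : ℕ)
    (A : Fin n → List (Fin d)) (x : Fin n → Fin d → 𝒜) (κ : Sym2 (Fin n) → ℝ)
    (hsemi : ∀ i u, IsSemicircular τ (x i u))
    (hjoint : IsJointlySemicircular τ fun p : Fin n × Fin d => x p.1 p.2)
    (hcov : ∀ (i j : Fin n) (u v : Fin d),
      τ (x i u * x j v) = if u = v then ((κ s(i, j) : ℝ) : ℂ) else 0) :
    -- the series that define the operators `Δ_{ij}` converge strongly
    (∀ (i j : Fin n) (ξ : FockSpace d),
      Summable fun l : ℕ => ((κ s(i, j) : ℝ) : ℂ) ^ (l + 1) • levelProj d (l + 1) ξ) ∧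
    -- the expansion; `σ` chooses in which order the two ends of each pair are labelled
    (∀ σ : Sym2 (Fin n) → Fin n × Fin n, (∀ e, s((σ e).1, (σ e).2) = e) →
      τ (List.ofFn fun i => evalMonomial (A i) (x i)).prod =
        ∑ K ∈ configurations n, ∑ k ∈ cutSystems A K,
          (∏ i ∈ isolated K, vacuumState (evalFock (A i))) *
            ∏ e ∈ K, pairTrace A κ K k (σ e).1 (σ e).2) ∧
    -- the symmetry identities
    (∀ (B C : List (Fin d)) (a b : Fin d) (l : ℕ),
      vacuumState (evalFock B * levelProj d l * evalFock C) =
        vacuumState (evalFock C * levelProj d l * evalFock B) ∧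
      vacuumState (evalFock B * leftAnnihilation a * levelProj d l * evalFock C) =
        vacuumState (evalFock C * levelProj d l * rightCreation a * evalFock B) ∧
      vacuumState (evalFock B * levelProj d l * rightCreation b * evalFock C) =
        vacuumState (evalFock C * leftAnnihilation b * levelProj d l * evalFock B) ∧
      vacuumState
          (evalFock B * leftAnnihilation a * levelProj d l * rightCreation b * evalFock C) =
        vacuumState
          (evalFock C * leftAnnihilation b * levelProj d l * rightCreation a * evalFock B)) := by
  refine ⟨fun i j ξ => summable_levelProj _ (fun hd => ?_) ξ, fun σ hσ => ?_,
    vacuumState_levelProj_symm⟩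
  · have h := hcov i j ⟨0, Nat.pos_of_ne_zero hd⟩ ⟨0, Nat.pos_of_ne_zero hd⟩
    rw [if_pos rfl] at h
    exact abs_covariance_le_one hτ (hsemi i _) (hsemi j _) h
  -- words longer than every `A a` never occur as links, so that any such bound on them will do
  · have hN : ∀ a, (A a).length < ∑ i, (A i).length + 1 := fun a => Nat.lt_succ_of_le
      (Finset.single_le_sum (f := fun i => (A i).length) (fun _ _ => Nat.zero_le _)
        (Finset.mem_univ a))
    rw [← linkSum_eq_sum_configurations _ κ A (fun a => (hN a).le) hσ]
    exact moment_eq_linkSum hτ hsemi hjoint hcov A _ hN
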